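/- Let $(X,x)$ be a complex analytic germ (not necessarily reduced) of dimension $d\ge 1$, that is, $\mathcal O_{X,x}=\mathcal O_{\mathbb C^n,x}/I$ for some $n$ and some proper ideal $I$ of the ring $\mathcal O_{\mathbb C^n,x}$ of germs of holomorphic functions, with $\dim\mathcal O_{X,x}=d$, and suppose that the local ring $\mathcal O_{X,x}$ is Cohen–Macaulay. Let $M\subset\mathcal O_{X,x}^p$ be a submodule of finite colength that is generated by $d+p-1$ elements, let $[M]$ be the $p\times(d+p-1)$ matrix with these generators as columns, and let $J(M)\subset\mathcal O_{X,x}$ be the ideal of maximal minors of $M$, i.e. the ideal generated by the $p\times p$ minors of $[M]$. Then the colength of $M$ equals the colength of $J(M)$: $$\operatorname{length}_{\mathcal O_{X,x}}\bigl(\mathcal O_{X,x}^p/M\bigr)=\operatorname{length}_{\mathcal O_{X,x}}\bigl(\mathcal O_{X,x}/J(M)\bigr).$$ -/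

import Mathlib

open Filter Topology

namespace AnalyticSpace

/-- The ring of germs at `z` of holomorphic functions on `ℂⁿ`, as a subring of the ring of germs at
`z` of all complex-valued functions. -/
def holoGerms (n : ℕ) (z : Fin n → ℂ) : Subring ((𝓝 z).Germ ℂ) where
  carrier := {g | ∃ f : (Fin n → ℂ) → ℂ, AnalyticAt ℂ f z ∧ (f : (𝓝 z).Germ ℂ) = g}
  mul_mem' := by
    rintro _ _ ⟨f, hf, rfl⟩ ⟨g, hg, rfl⟩
    exact ⟨f * g, hf.mul hg, rfl⟩
  one_mem' := ⟨1, analyticAt_const, rfl⟩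
  add_mem' := by
    rintro _ _ ⟨f, hf, rfl⟩ ⟨g, hg, rfl⟩
    exact ⟨f + g, hf.add hg, rfl⟩
  zero_mem' := ⟨0, analyticAt_const, rfl⟩
  neg_mem' := by
    rintro _ ⟨f, hf, rfl⟩
    exact ⟨-f, hf.neg, rfl⟩

/-- The ring `𝒪_{ℂⁿ,z}`. -/
abbrev OAmbient (n : ℕ) (z : Fin n → ℂ) : Type := holoGerms n z

/-- The local ring `𝒪_{X,z} = 𝒪_{ℂⁿ,z} / I` of the germ at `z` of the (not necessarily reduced)
complex analytic space `X ⊆ ℂⁿ` whose ideal at `z` is `I`. -/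
abbrev OLocal {n : ℕ} {z : Fin n → ℂ} (I : Ideal (OAmbient n z)) : Type := OAmbient n z ⧸ I

theorem isUnit_of_value_ne_zero {n : ℕ} {z : Fin n → ℂ} {f : (Fin n → ℂ) → ℂ}
    (hf : AnalyticAt ℂ f z) (h0 : f z ≠ 0) :
    IsUnit (⟨(f : (𝓝 z).Germ ℂ), f, hf, rfl⟩ : OAmbient n z) := by
  refine IsUnit.of_mul_eq_one ⟨((f⁻¹ : (Fin n → ℂ) → ℂ) : (𝓝 z).Germ ℂ), f⁻¹, hf.inv h0, rfl⟩ ?_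
  apply Subtype.ext
  refine Filter.Germ.coe_eq.mpr ?_
  filter_upwards [hf.continuousAt.eventually_ne h0] with w hw
  exact mul_inv_cancel₀ hw

instance instNontrivialOAmbient (n : ℕ) (z : Fin n → ℂ) : Nontrivial (OAmbient n z) :=
  inferInstance

instance instIsLocalRingOAmbient (n : ℕ) (z : Fin n → ℂ) : IsLocalRing (OAmbient n z) := by
  refine IsLocalRing.of_isUnit_or_isUnit_one_sub_self ?_
  rintro ⟨_, f, hf, rfl⟩
  by_cases h0 : f z = 0
  · right
    exact isUnit_of_value_ne_zero (f := 1 - f) (analyticAt_const.sub hf) (by simp [h0])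
  · left
    exact isUnit_of_value_ne_zero hf h0

instance instIsLocalRingOLocal {n : ℕ} {z : Fin n → ℂ} (I : Ideal (OAmbient n z))
    [Nontrivial (OLocal I)] : IsLocalRing (OLocal I) :=
  IsLocalRing.of_surjective' (Ideal.Quotient.mk I) Ideal.Quotient.mk_surjective

/-- `x₁, …, x_k` is a system of parameters of the local ring `R`: `k = dim R`, the `xᵢ` lie in the
maximal ideal, and `R / (x₁, …, x_k)` has finite length. -/
def IsSystemOfParameters (R : Type*) [CommRing R] [IsLocalRing R] (xs : List R) : Prop :=
  (xs.length : WithBot ℕ∞) = ringKrullDim R ∧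
    (∀ x ∈ xs, x ∈ IsLocalRing.maximalIdeal R) ∧
    IsFiniteLength R (R ⧸ Ideal.ofList xs)

/-- A (Noetherian) local ring is Cohen–Macaulay if some system of parameters is a regular
sequence. -/
def IsCohenMacaulay (R : Type*) [CommRing R] [IsLocalRing R] : Prop :=
  ∃ xs : List R, IsSystemOfParameters R xs ∧ RingTheory.Sequence.IsRegular R xs

/-- The ideal of maximal minors of a `p × m` matrix: it is generated by the determinants of the
`p × p` submatrices obtained by choosing `p` of the `m` columns. -/
def maximalMinors {R : Type*} [CommRing R] {p m : ℕ} (A : Matrix (Fin p) (Fin m) R) : Ideal R :=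
  Ideal.span (Set.range fun s : Fin p ↪o Fin m => (A.submatrix id s).det)

end AnalyticSpace

/-!
The theorem compares the colengths of a module and of its ideal of maximal minors. It is
classical that both are computed by complexes of the same length (Buchsbaum–Rim and Eagon–Northcott).
The proof here is elementary: induction on the dimension `d`, and on the rank `p`, by exchanging
one column of the matrix at a time.

Let `R` be a Noetherian local ring that contains an infinite field, and let `I` be an ideal such
that `R / I` is Cohen–Macaulay of dimension `d`. Rings such as `R / (I, x)` are not formed; all
statements are about ideals of `R` and about submodules of `Rᵖ` modulo `I`. A matrix with `p` rows
and `d + p - 1` columns is a linear map `f`. Two statements are proved together: the equality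
of colengths (`ColengthFormula`) and the fact that all syzygies of the columns come from Cramer's
rule (`SyzygiesCramer`).

* Let `M` be generated by all columns but one, after a general change of basis. Then the minors of
  `M` define a scheme of dimension one (`exists_generic_columns`, a dimension count over primes of
  a polynomial ring). If `u` is the first parameter, `M` is a matrix of the right size for
  `R / (I, u)` and for all `R / (I, uʲ)`, to which the induction hypothesis applies. It follows that
  `u` is regular on the cokernel of `M` (`regular_coker_of_syzygies`). So the colengths of `M`
  modulo `uʲ` grow linearly in `j`, and so do those of its minors; therefore `u` is
  regular modulo the minors of `M` (`regular_of_length_pow`), which is all that is needed of the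
  Cohen–Macaulay property of determinantal schemes.
* Under this regularity the difference of the colengths of `M + (v)` and of its minors does not
  depend on `v` (`length_exchange`). For a suitable `v` with first coordinate `1`
  (`exists_unit_column`) the vector `v` can be split off, which lowers `p` by one. The formula is
  trivial for `p = 0`.
* The Cramer syzygies lift from `(I, u)` to `I` by Nakayama's lemma
  (`mem_cramerSyzygies_of_regular`), and from `M` to the whole matrix
  (`mem_cramerSyzygies_of_tail`).

The local ring `𝒪` of the germ is not known to be Noetherian in Mathlib, but the existence of a
system of parameters makes its maximal ideal finitely generated, and its completion is a quotient
of a formal power series ring over `ℂ` (`isNoetherianRing_adicCompletion`). The regular sequence and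
both colengths pass from `𝒪` to the completion, because ideals that contain a power of the maximal
ideal are the same in both rings (`IsCompletionMap.regular_map`, `IsCompletionMap.length_eq`).
-/

namespace AnalyticSpace

open IsLocalRing
open scoped Matrix

/-! ### Regular sequences -/

section RegularSequences

variable {R : Type*} [CommRing R]

/-- `x₁, …, x_k` is a weakly regular sequence modulo the ideal `I`. All the rings
`R / (I, x₁, …, xᵢ)` are handled as ideals of the fixed ring `R`. -/
def RegSeq (I : Ideal R) : List R → Prop
  | [] => True
  | x :: xs => (∀ y, x * y ∈ I → y ∈ I) ∧ RegSeq (I ⊔ Ideal.span {x}) xs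

theorem mem_sup_span_singleton {I : Ideal R} {x y : R} :
    y ∈ I ⊔ Ideal.span {x} ↔ ∃ c, y - x * c ∈ I := by
  rw [Submodule.mem_sup]
  constructor
  · rintro ⟨i, hi, z, hz, rfl⟩
    obtain ⟨c, rfl⟩ := Ideal.mem_span_singleton.mp hz
    exact ⟨c, by simpa using hi⟩
  · rintro ⟨c, hc⟩
    exact ⟨_, hc, x * c, Ideal.mul_mem_right _ _ (Ideal.mem_span_singleton_self x), by ring⟩

/-- If `x` is regular modulo `I` and `y` is regular modulo `(I, x)`, then `x` is regular
modulo `(I, y)`. -/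
theorem regular_mod_swap {I : Ideal R} {x y : R} (hx : ∀ z, x * z ∈ I → z ∈ I)
    (hy : ∀ z, y * z ∈ I ⊔ Ideal.span {x} → z ∈ I ⊔ Ideal.span {x}) :
    ∀ z, x * z ∈ I ⊔ Ideal.span {y} → z ∈ I ⊔ Ideal.span {y} := by
  intro z hz
  obtain ⟨c, hc⟩ := mem_sup_span_singleton.mp hz
  have h1 : y * c ∈ I ⊔ Ideal.span {x} :=
    mem_sup_span_singleton.mpr ⟨z, by simpa using I.neg_mem hc⟩
  obtain ⟨e, he⟩ := mem_sup_span_singleton.mp (hy c h1)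
  refine mem_sup_span_singleton.mpr ⟨e, hx _ ?_⟩
  have := I.add_mem hc (I.mul_mem_left y he)
  convert this using 1
  ring

theorem regular_mod_pow {I : Ideal R} {x : R} (hx : ∀ z, x * z ∈ I → z ∈ I) (n : ℕ) :
    ∀ z, x ^ n * z ∈ I → z ∈ I := by
  induction n with
  | zero => intro z hz; simpa using hz
  | succ n ih => exact fun z hz => ih z (hx _ (by rwa [pow_succ', mul_assoc] at hz))

theorem regular_mod_sup_pow {I : Ideal R} {u x : R} (hu : ∀ z, u * z ∈ I → z ∈ I)
    (hx : ∀ z, x * z ∈ I ⊔ Ideal.span {u} → z ∈ I ⊔ Ideal.span {u}) (n : ℕ) :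
    ∀ z, x * z ∈ I ⊔ Ideal.span {u ^ n} → z ∈ I ⊔ Ideal.span {u ^ n} := by
  induction n with
  | zero => intro z _; simp
  | succ n ih =>
    intro z hz
    obtain ⟨c, hc⟩ := mem_sup_span_singleton.mp hz
    have h1 : x * z ∈ I ⊔ Ideal.span {u} :=
      mem_sup_span_singleton.mpr ⟨u ^ n * c, by convert hc using 1; ring⟩
    obtain ⟨e, he⟩ := mem_sup_span_singleton.mp (hx z h1)
    have h2 : x * e ∈ I ⊔ Ideal.span {u ^ n} := by
      refine mem_sup_span_singleton.mpr ⟨c, hu _ ?_⟩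
      have := I.sub_mem hc (I.mul_mem_left x he)
      convert this using 1
      ring
    obtain ⟨g, hg⟩ := mem_sup_span_singleton.mp (ih e h2)
    refine mem_sup_span_singleton.mpr ⟨g, ?_⟩
    have := I.add_mem he (I.mul_mem_left u hg)
    convert this using 1
    ring

/-- A sequence that is regular modulo `(I, u)` is regular modulo `(I, uⁿ)`, for `u` regular
modulo `I`. -/
theorem RegSeq.sup_pow {xs : List R} : ∀ {I : Ideal R} {u : R}, (∀ z, u * z ∈ I → z ∈ I) →
    RegSeq (I ⊔ Ideal.span {u}) xs → ∀ n, RegSeq (I ⊔ Ideal.span {u ^ n}) xs := by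
  induction xs with
  | nil => intros; trivial
  | cons x xs ih =>
    intro I u hu h n
    refine ⟨regular_mod_sup_pow hu h.1 n, ?_⟩
    have h2 := h.2
    rw [sup_right_comm] at h2 ⊢
    exact ih (regular_mod_swap hu h.1) h2 n

theorem RegSeq.map_pow {xs : List R} (n : ℕ) :
    ∀ {I : Ideal R}, RegSeq I xs → RegSeq I (xs.map (· ^ n)) := by
  induction xs with
  | nil => intros; trivial
  | cons x xs ih =>
    intro I h
    exact ⟨regular_mod_pow h.1 n, RegSeq.sup_pow h.1 (ih h.2) n⟩

/-- The first element of a regular sequence is regular modulo the remaining ones. -/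
theorem RegSeq.head_regular {xs : List R} :
    ∀ {I : Ideal R} {y : R}, RegSeq I (y :: xs) →
      ∀ z, y * z ∈ I ⊔ Ideal.ofList xs → z ∈ I ⊔ Ideal.ofList xs := by
  induction xs with
  | nil => intro I y h z hz; simpa using h.1 z (by simpa using hz)
  | cons x xs ih =>
    intro I y h
    rw [Ideal.ofList_cons, ← sup_assoc]
    refine ih ⟨regular_mod_swap h.1 h.2.1, ?_⟩
    rw [sup_right_comm]
    exact h.2.2

end RegularSequences

/-! ### Lengths and submodules of finite colength -/

section Lengths

variable {R : Type*} [CommRing R]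

/-- Additivity of length along `0 → E / g⁻¹ A → F / A → F / (A + g E) → 0`. -/
theorem length_quotient_comap {E F : Type*} [AddCommGroup E] [Module R E] [AddCommGroup F]
    [Module R F] (g : E →ₗ[R] F) (A : Submodule R F) :
    Module.length R (F ⧸ A) =
      Module.length R (E ⧸ A.comap g) + Module.length R (F ⧸ (A ⊔ LinearMap.range g)) := by
  refine Module.length_eq_add_of_exact (Submodule.mapQ _ A g le_rfl)
    (Submodule.factor le_sup_left) ?_ (Submodule.factor_surjective _) ?_
  · rw [← LinearMap.ker_eq_bot, Submodule.ker_mapQ]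
    simp
  · rw [LinearMap.exact_iff]
    ext x
    obtain ⟨x, rfl⟩ := Submodule.Quotient.mk_surjective _ x
    have h1 : Submodule.Quotient.mk x ∈ LinearMap.ker (Submodule.factor (le_sup_left :
        A ≤ A ⊔ LinearMap.range g)) ↔ x ∈ A ⊔ LinearMap.range g := by
      exact Submodule.Quotient.mk_eq_zero _
    rw [h1, Submodule.mem_sup]
    constructor
    · rintro ⟨a, ha, _, ⟨e, rfl⟩, rfl⟩
      refine ⟨Submodule.Quotient.mk e, ?_⟩
      rw [Submodule.mapQ_apply, Submodule.Quotient.eq]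
      simpa using A.neg_mem ha
    · rintro ⟨e, he⟩
      obtain ⟨e, rfl⟩ := Submodule.Quotient.mk_surjective _ e
      rw [Submodule.mapQ_apply, Submodule.Quotient.eq] at he
      exact ⟨x - g e, by simpa using A.neg_mem he, g e, ⟨e, rfl⟩, by simp⟩

theorem length_quotient_span_singleton {F : Type*} [AddCommGroup F] [Module R F]
    (A : Submodule R F) (x : F) (J : Ideal R) (hJ : ∀ r, r • x ∈ A ↔ r ∈ J) :
    Module.length R (F ⧸ A) =
      Module.length R (R ⧸ J) + Module.length R (F ⧸ (A ⊔ Submodule.span R {x})) := by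
  have h := length_quotient_comap (LinearMap.toSpanSingleton R F x) A
  have h1 : A.comap (LinearMap.toSpanSingleton R F x) = J := by
    ext r
    simp [hJ]
  rwa [h1, LinearMap.range_toSpanSingleton] at h

/-- The vectors of `R^ι` all of whose coordinates lie in the ideal `I`. -/
abbrev coordIdeal (ι : Type*) (I : Ideal R) : Submodule R (ι → R) :=
  Submodule.pi Set.univ fun _ => I

theorem mem_coordIdeal {ι : Type*} {I : Ideal R} {y : ι → R} :
    y ∈ coordIdeal ι I ↔ ∀ i, y i ∈ I := by
  simp [coordIdeal]

theorem coordIdeal_mono {ι : Type*} {I J : Ideal R} (h : I ≤ J) :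
    coordIdeal ι I ≤ coordIdeal ι J :=
  fun _ hy => mem_coordIdeal.mpr fun i => h (mem_coordIdeal.mp hy i)

theorem apply_mem_coordIdeal {ι κ : Type*} [Fintype ι] {I : Ideal R}
    (f : (ι → R) →ₗ[R] (κ → R)) {b : ι → R} (hb : b ∈ coordIdeal ι I) :
    f b ∈ coordIdeal κ I := by
  classical
  rw [pi_eq_sum_univ' b, map_sum]
  refine Submodule.sum_mem _ fun i _ => ?_
  rw [map_smul, mem_coordIdeal]
  exact fun j => I.mul_mem_right _ (mem_coordIdeal.mp hb i)

variable [IsLocalRing R]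

theorem length_quotient_ne_top [IsNoetherianRing R] {I : Ideal R} {n : ℕ}
    (h : maximalIdeal R ^ n ≤ I) : Module.length R (R ⧸ I) ≠ ⊤ := by
  by_cases hI : I = ⊤
  · have := Ideal.Quotient.subsingleton_iff.mpr hI
    simp
  have := Ideal.Quotient.nontrivial_iff.mpr hI
  have : IsLocalRing (R ⧸ I) :=
    IsLocalRing.of_surjective' (Ideal.Quotient.mk I) Ideal.Quotient.mk_surjective
  have : IsArtinianRing (R ⧸ I) := by
    rw [isArtinianRing_iff_isNilpotent_maximalIdeal]
    refine ⟨n, ?_⟩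
    have h1 : maximalIdeal (R ⧸ I) ≤ (maximalIdeal R).map (Ideal.Quotient.mk I) := by
      intro y hy
      obtain ⟨y, rfl⟩ := Ideal.Quotient.mk_surjective y
      refine Ideal.mem_map_of_mem _ ?_
      rw [mem_maximalIdeal] at hy ⊢
      exact fun hu => hy (hu.map _)
    refine le_bot_iff.mp ((Ideal.pow_right_mono h1 n).trans ?_)
    rw [← Ideal.map_pow]
    exact (Ideal.map_mono h).trans (by simp)
  rw [Module.length_eq_of_surjective (R := R ⧸ I) (S := R) Ideal.Quotient.mk_surjective]
  exact Module.length_ne_top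

/-- A submodule of `R^ι` that contains all vectors with coordinates in `𝔪ⁿ`, for some `n`; for
finite `ι` over a Noetherian local ring these are the submodules of finite colength. -/
def Cofinite {ι : Type*} (M : Submodule R (ι → R)) : Prop :=
  ∃ n : ℕ, coordIdeal ι (maximalIdeal R ^ n) ≤ M

theorem Cofinite.mono {ι : Type*} {M N : Submodule R (ι → R)} (h : Cofinite M) (hMN : M ≤ N) :
    Cofinite N :=
  ⟨h.choose, h.choose_spec.trans hMN⟩

theorem Cofinite.length_ne_top [IsNoetherianRing R] {ι : Type*} [Finite ι]
    {M : Submodule R (ι → R)} (h : Cofinite M) : Module.length R ((ι → R) ⧸ M) ≠ ⊤ := by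
  classical
  have := Fintype.ofFinite ι
  obtain ⟨n, hn⟩ := h
  refine ne_top_of_le_ne_top ?_
    (Module.length_le_of_surjective (Submodule.factor hn) (Submodule.factor_surjective hn))
  rw [(Submodule.quotientPi fun _ : ι => maximalIdeal R ^ n).length_eq, Module.length_pi_of_fintype]
  exact WithTop.sum_ne_top.mpr fun i _ => length_quotient_ne_top le_rfl

/-- A power of the maximal ideal kills a module of finite length; the ring need not be
Noetherian. -/
theorem exists_pow_le_of_isFiniteLength {F : Type*} [AddCommGroup F] [Module R F]
    (hF : IsFiniteLength R F) : ∃ n, maximalIdeal R ^ n • (⊤ : Submodule R F) = ⊥ := by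
  obtain ⟨_, _⟩ := isFiniteLength_iff_isNoetherian_isArtinian.mp hF
  let s : ℕ →o (Submodule R F)ᵒᵈ :=
    ⟨fun n => OrderDual.toDual (maximalIdeal R ^ n • (⊤ : Submodule R F)), fun a b h =>
      Submodule.smul_mono_left (Ideal.pow_le_pow_right h)⟩
  obtain ⟨n, hn⟩ := IsArtinian.monotone_stabilizes s
  refine ⟨n, ?_⟩
  have h1 : maximalIdeal R ^ n • (⊤ : Submodule R F) =
      maximalIdeal R ^ (n + 1) • (⊤ : Submodule R F) := hn (n + 1) n.le_succ
  rw [pow_succ', Submodule.mul_smul] at h1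
  exact Submodule.eq_bot_of_le_smul_of_le_jacobson_bot _ _ (IsNoetherian.noetherian _) h1.le
    (maximalIdeal_le_jacobson ⊥)

/-- Krull's intersection theorem in the ring `R / J`. -/
theorem mem_of_pow_le [IsNoetherianRing R] {J : Ideal R} {y : R}
    (h : ∀ n, y ∈ J ⊔ maximalIdeal R ^ n) : y ∈ J := by
  have h1 := (IsHausdorff.haus (inferInstance : IsHausdorff (maximalIdeal R) (R ⧸ J))
    (Ideal.Quotient.mk J y) fun n => ?_)
  · exact Ideal.Quotient.eq_zero_iff_mem.mp h1
  · rw [SModEq.zero]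
    obtain ⟨a, ha, b, hb, rfl⟩ := Submodule.mem_sup.mp (h n)
    rw [map_add, Ideal.Quotient.eq_zero_iff_mem.mpr ha, zero_add]
    have : (Ideal.Quotient.mk J b) = b • (1 : R ⧸ J) := by
      rw [Algebra.smul_def, mul_one]; rfl
    rw [this]
    exact Submodule.smul_mem_smul hb trivial

end Lengths

/-! ### The ideal of maximal minors -/

section Minors

variable {R : Type*} [CommRing R]

/-- The ideal of maximal minors of a submodule `M` of `Rᵖ`: it is generated by the determinants of
all `p × p` matrices whose rows lie in `M`. -/
def minorIdeal {p : ℕ} (M : Submodule R (Fin p → R)) : Ideal R :=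
  Ideal.span {r | ∃ w : Fin p → Fin p → R, (∀ i, w i ∈ M) ∧ (Matrix.of w).det = r}

theorem det_mem_minorIdeal {p : ℕ} {M : Submodule R (Fin p → R)} {w : Fin p → Fin p → R}
    (hw : ∀ i, w i ∈ M) : (Matrix.of w).det ∈ minorIdeal M :=
  Ideal.subset_span ⟨w, hw, rfl⟩

theorem minorIdeal_mono {p : ℕ} {M N : Submodule R (Fin p → R)} (h : M ≤ N) :
    minorIdeal M ≤ minorIdeal N :=
  Ideal.span_mono fun _ ⟨w, hw, e⟩ => ⟨w, fun i => h (hw i), e⟩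

theorem minorIdeal_le {p : ℕ} {M : Submodule R (Fin p → R)} {J : Ideal R}
    (h : ∀ w : Fin p → Fin p → R, (∀ i, w i ∈ M) → (Matrix.of w).det ∈ J) : minorIdeal M ≤ J :=
  Ideal.span_le.mpr fun _ ⟨w, hw, e⟩ => e ▸ h w hw

/-- Cramer's rule for the rows of a square matrix. -/
theorem sum_cramer_smul {p : ℕ} (w : Fin p → Fin p → R) (y : Fin p → R) :
    ∑ i, Matrix.cramer (Matrix.of w)ᵀ y i • w i = (Matrix.of w).det • y := by
  have h := Matrix.mulVec_cramer (Matrix.of w)ᵀ y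
  rw [Matrix.det_transpose] at h
  rw [← h]
  ext j
  simp [Matrix.mulVec, dotProduct, mul_comm]

/-- The maximal minors of `M` kill the quotient by `M`, by Cramer's rule. -/
theorem smul_mem_of_mem_minorIdeal {p : ℕ} {M : Submodule R (Fin p → R)} {r : R}
    (hr : r ∈ minorIdeal M) (y : Fin p → R) : r • y ∈ M := by
  have h : minorIdeal M ≤ M.comap (LinearMap.toSpanSingleton R _ y) := by
    refine minorIdeal_le fun w hw => ?_
    rw [Submodule.mem_comap, LinearMap.toSpanSingleton_apply, ← sum_cramer_smul]
    exact Submodule.sum_mem _ fun i _ => M.smul_mem _ (hw i)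
  exact h hr

theorem smul_mem_of_mem_minorIdeal_sup {p : ℕ} {M : Submodule R (Fin p → R)} {I : Ideal R} {r : R}
    (hr : r ∈ minorIdeal M ⊔ I) (y : Fin p → R) : r • y ∈ M ⊔ coordIdeal _ I := by
  obtain ⟨a, ha, b, hb, rfl⟩ := Submodule.mem_sup.mp hr
  rw [add_smul]
  exact Submodule.add_mem_sup (smul_mem_of_mem_minorIdeal ha y)
    (mem_coordIdeal.mpr fun i => I.mul_mem_right _ hb)

/-- The linear functional `y ↦ det (y, c₁, …, c_q)`. -/
def detFun {q : ℕ} (c : Fin q → Fin (q + 1) → R) : (Fin (q + 1) → R) →ₗ[R] R :=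
  (Matrix.detRowAlternating (n := Fin (q + 1)) (R := R)).toMultilinearMap.toLinearMap
    (Fin.cons 0 c) 0

theorem detFun_apply {q : ℕ} (c : Fin q → Fin (q + 1) → R) (y : Fin (q + 1) → R) :
    detFun c y = (Matrix.of (Fin.cons y c : Fin (q + 1) → Fin (q + 1) → R)).det := by
  simp only [detFun, MultilinearMap.toLinearMap_apply, Fin.update_cons_zero]
  rfl

/-- The functionals `det (·, c₁, …, c_q)` with all `cᵢ` in `M`, and their linear combinations. -/
def minorFunctionals {q : ℕ} (M : Submodule R (Fin (q + 1) → R)) :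
    Submodule R ((Fin (q + 1) → R) →ₗ[R] R) :=
  Submodule.span R {φ | ∃ c : Fin q → Fin (q + 1) → R, (∀ i, c i ∈ M) ∧ detFun c = φ}

theorem detFun_mem {q : ℕ} {M : Submodule R (Fin (q + 1) → R)} {c : Fin q → Fin (q + 1) → R}
    (hc : ∀ i, c i ∈ M) : detFun c ∈ minorFunctionals M :=
  Submodule.subset_span ⟨c, hc, rfl⟩

/-- The relation among the `q + 2` vectors `v, w, c₁, …, c_q` of `R^(q+1)` given by Cramer's rule. -/
theorem minorFunctional_smul_sub_mem {q : ℕ} {M : Submodule R (Fin (q + 1) → R)}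
    {φ : (Fin (q + 1) → R) →ₗ[R] R} (hφ : φ ∈ minorFunctionals M) (v w : Fin (q + 1) → R) :
    φ v • w - φ w • v ∈ M := by
  induction hφ using Submodule.span_induction with
  | mem φ h =>
    obtain ⟨c, hc, rfl⟩ := h
    have h := sum_cramer_smul (Fin.cons v c : Fin (q + 1) → Fin (q + 1) → R) w
    rw [Fin.sum_univ_succ] at h
    have h0 : Matrix.cramer (Matrix.of (Fin.cons v c : Fin (q + 1) → Fin (q + 1) → R))ᵀ w 0 =
        detFun c w := by
      rw [Matrix.cramer_transpose_apply, detFun_apply]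
      congr 1
      have := Fin.update_cons_zero (α := fun _ => Fin (q + 1) → R) v c w
      exact this
    rw [h0, ← detFun_apply] at h
    rw [← h]
    simp only [Fin.cons_zero, Fin.cons_succ, add_sub_cancel_left]
    exact Submodule.sum_mem _ fun i _ => M.smul_mem _ (hc i)
  | zero => simp
  | add φ ψ _ _ h1 h2 =>
    convert M.add_mem h1 h2 using 1
    simp only [LinearMap.add_apply, add_smul]
    abel
  | smul r φ _ h =>
    convert M.smul_mem r h using 1
    simp only [LinearMap.smul_apply, smul_sub, smul_smul, smul_eq_mul]

theorem minorFunctional_apply_mem {q : ℕ} {M : Submodule R (Fin (q + 1) → R)}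
    {φ : (Fin (q + 1) → R) →ₗ[R] R} (hφ : φ ∈ minorFunctionals M) {N : Submodule R (Fin (q + 1) → R)}
    (hMN : M ≤ N) {y : Fin (q + 1) → R} (hy : y ∈ N) : φ y ∈ minorIdeal N := by
  induction hφ using Submodule.span_induction with
  | mem φ h =>
    obtain ⟨c, hc, rfl⟩ := h
    rw [detFun_apply]
    refine det_mem_minorIdeal fun i => ?_
    cases i using Fin.cases with
    | zero => exact hy
    | succ i => exact hMN (hc i)
  | zero => simp
  | add φ ψ _ _ h1 h2 => exact add_mem h1 h2
  | smul r φ _ h => exact Ideal.mul_mem_left _ r h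

theorem functional_apply_mem {ι : Type*} [Fintype ι] {I : Ideal R} (φ : (ι → R) →ₗ[R] R)
    {y : ι → R} (hy : y ∈ coordIdeal ι I) : φ y ∈ I := by
  classical
  rw [pi_eq_sum_univ' y, map_sum]
  refine Submodule.sum_mem _ fun i _ => ?_
  rw [map_smul]
  exact I.mul_mem_right _ (mem_coordIdeal.mp hy i)

theorem minorFunctional_apply_mem_sup {q : ℕ} {M : Submodule R (Fin (q + 1) → R)} {I : Ideal R}
    {φ : (Fin (q + 1) → R) →ₗ[R] R} (hφ : φ ∈ minorFunctionals M) {y : Fin (q + 1) → R}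
    (hy : y ∈ M ⊔ coordIdeal _ I) : φ y ∈ minorIdeal M ⊔ I := by
  obtain ⟨a, ha, b, hb, rfl⟩ := Submodule.mem_sup.mp hy
  rw [map_add]
  exact Submodule.add_mem_sup (minorFunctional_apply_mem hφ le_rfl ha) (functional_apply_mem φ hb)

/-- Expansion of a determinant along the row `v`, which is moved to the top by a cyclic
permutation. -/
theorem det_update_mem {q : ℕ} {M : Submodule R (Fin (q + 1) → R)}
    {m : Fin (q + 1) → Fin (q + 1) → R} (hm : ∀ i, m i ∈ M) (v : Fin (q + 1) → R)
    (i : Fin (q + 1)) : Matrix.detRowAlternating (Function.update m i v) ∈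
      (minorFunctionals M).map (LinearMap.applyₗ v) := by
  have h1 : (Fin.cons v (fun j => m (i.succAbove j)) : Fin (q + 1) → Fin (q + 1) → R) =
      Function.update m i v ∘ i.cycleRange.symm := by
    ext1 j
    cases j using Fin.cases with
    | zero => simp
    | succ j => simp [Fin.succAbove_ne]
  have h2 : Matrix.detRowAlternating
      (Fin.cons v (fun j => m (i.succAbove j)) : Fin (q + 1) → Fin (q + 1) → R) ∈
      (minorFunctionals M).map (LinearMap.applyₗ v) :=
    ⟨_, detFun_mem fun j => hm (i.succAbove j), detFun_apply _ _⟩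
  rw [h1, AlternatingMap.map_perm] at h2
  rcases Int.units_eq_one_or (Equiv.Perm.sign i.cycleRange.symm) with h | h
  · simpa [h] using h2
  · simpa [h] using h2

/-- By multilinearity, the maximal minors of `M + (v)` are those of `M` and those in which `v` occurs
exactly once. -/
theorem minorIdeal_sup_span_singleton {q : ℕ} (M : Submodule R (Fin (q + 1) → R))
    (v : Fin (q + 1) → R) :
    minorIdeal (M ⊔ Submodule.span R {v}) =
      minorIdeal M ⊔ (minorFunctionals M).map (LinearMap.applyₗ v) := by
  classical
  apply le_antisymm
  · refine minorIdeal_le fun w hw => ?_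
    have hw' : ∀ i, ∃ m ∈ M, ∃ r : R, w i = m + r • v := by
      intro i
      obtain ⟨a, ha, b, hb, e⟩ := Submodule.mem_sup.mp (hw i)
      obtain ⟨r, rfl⟩ := Submodule.mem_span_singleton.mp hb
      exact ⟨a, ha, r, e.symm⟩
    choose m hm r hr using hw'
    have h1 : (Matrix.of w).det = Matrix.detRowAlternating (m + fun i => r i • v) := by
      have hwm : w = m + fun i => r i • v := funext hr
      rw [hwm]
      rfl
    rw [h1]
    have h2 := (Matrix.detRowAlternating (n := Fin (q + 1)) (R := R)).toMultilinearMap.map_add_univ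
      m (fun i => r i • v)
    rw [AlternatingMap.coe_multilinearMap] at h2
    rw [h2]
    refine Submodule.sum_mem _ fun s _ => ?_
    -- In the term of `s`, the rows outside `s` are multiples of `v`.
    by_cases hs : s = Finset.univ
    · subst hs
      rw [Finset.piecewise_univ]
      exact Submodule.mem_sup_left (det_mem_minorIdeal hm)
    obtain ⟨i, hi⟩ : ∃ i, i ∉ s := by
      by_contra! h
      exact hs (Finset.eq_univ_iff_forall.mpr h)
    have h3 : ∀ (W : Fin (q + 1) → Fin (q + 1) → R) (i : Fin (q + 1)), W i = r i • v →
        Matrix.detRowAlternating W = r i • Matrix.detRowAlternating (Function.update W i v) := by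
      intro W i hW
      rw [← AlternatingMap.map_update_smul, ← hW, Function.update_eq_self]
    rw [h3 _ i (by simp [hi])]
    by_cases hs' : s = Finset.univ.erase i
    · refine Submodule.smul_mem _ _ (Submodule.mem_sup_right ?_)
      have h4 : Function.update (s.piecewise m fun i => r i • v) i v = Function.update m i v := by
        ext1 j
        by_cases hj : j = i
        · subst hj; simp
        · simp [hj, hs']
      rw [h4]
      exact det_update_mem hm v i
    · obtain ⟨j, hj, hji⟩ : ∃ j, j ∉ s ∧ j ≠ i := by
        by_contra! h
        refine hs' (Finset.ext fun j => ?_)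
        simp only [Finset.mem_erase, Finset.mem_univ, and_true]
        exact ⟨fun h1 h2 => hi (h2 ▸ h1), fun h1 => by_contra fun h2 => h1 (h j h2)⟩
      rw [h3 (Function.update _ i v) j (by simp [hj, hji]),
        AlternatingMap.map_eq_zero_of_eq _ _ (i := i) (j := j) (by simp [hji.symm]) hji.symm]
      simp
  · refine sup_le (minorIdeal_mono le_sup_left) ?_
    rintro _ ⟨φ, hφ, rfl⟩
    exact minorFunctional_apply_mem hφ le_sup_left
      (Submodule.mem_sup_right (Submodule.mem_span_singleton_self v))

theorem det_mem_minorIdeal_sup {p : ℕ} {M : Submodule R (Fin p → R)} {I : Ideal R}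
    {w : Fin p → Fin p → R} (hw : ∀ i, w i ∈ M ⊔ coordIdeal _ I) :
    (Matrix.of w).det ∈ minorIdeal M ⊔ I := by
  have hw' : ∀ i, ∃ m ∈ M, w i - m ∈ coordIdeal _ I := by
    intro i
    obtain ⟨a, ha, b, hb, e⟩ := Submodule.mem_sup.mp (hw i)
    exact ⟨a, ha, by rw [← e]; simpa using hb⟩
  choose m hm hd using hw'
  have h : (Matrix.of w).det - (Matrix.of m).det ∈ I := by
    rw [← Ideal.Quotient.eq_zero_iff_mem, map_sub, sub_eq_zero, RingHom.map_det, RingHom.map_det]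
    congr 1
    ext i j
    exact Ideal.Quotient.eq.mpr (mem_coordIdeal.mp (hd i) j)
  rw [← sub_add_cancel (Matrix.of w).det (Matrix.of m).det, add_comm]
  exact Submodule.add_mem_sup (det_mem_minorIdeal hm) h

/-- There are no nonzero maximal minors if there are too few columns. -/
theorem minorIdeal_range_of_fin {q : ℕ} (g : (Fin q → R) →ₗ[R] (Fin (q + 1) → R)) :
    minorIdeal (LinearMap.range g) = ⊥ := by
  refine le_bot_iff.mp (minorIdeal_le fun w hw => ?_)
  choose b hb using hw
  let B : Matrix (Fin (q + 1)) (Fin (q + 1)) R := Matrix.of fun i => Fin.cons 0 (b i)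
  let G : Matrix (Fin (q + 1)) (Fin (q + 1)) R :=
    Matrix.of (Fin.cons 0 fun j => g (Pi.single j 1))
  have h1 : Matrix.of w = B * G := by
    ext i j
    rw [Matrix.mul_apply, Fin.sum_univ_succ]
    simp only [B, G, Matrix.of_apply, Fin.cons_zero, Fin.cons_succ, zero_mul, zero_add]
    rw [← hb i]
    conv_lhs => rw [pi_eq_sum_univ' (b i), map_sum]
    simp [Finset.sum_apply]
  have h2 : B.det = 0 := Matrix.det_eq_zero_of_column_eq_zero 0 fun i => rfl
  rw [h1, Matrix.det_mul, h2, zero_mul]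
  exact zero_mem _

/-- If `f b` vanishes modulo `I` for an endomorphism `f` of `Rᵖ`, then every maximal minor of
`f` kills `b` modulo `I`. -/
theorem mul_apply_mem_of_mem_minorIdeal {p : ℕ} {I : Ideal R} (f : (Fin p → R) →ₗ[R] (Fin p → R))
    {b : Fin p → R} (hb : f b ∈ coordIdeal _ I) {r : R}
    (hr : r ∈ minorIdeal (LinearMap.range f) ⊔ I) (i : Fin p) : r * b i ∈ I := by
  have h1 : LinearMap.det f * b i ∈ I := by
    have h := Matrix.adjugate_mul (LinearMap.toMatrix' f)
    rw [LinearMap.det_toMatrix'] at h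
    have h2 : LinearMap.det f • b = (LinearMap.toMatrix' f).adjugate.mulVecLin (f b) := by
      have h3 : f b = (LinearMap.toMatrix' f).mulVec b := by
        rw [← Matrix.toLin'_apply, Matrix.toLin'_toMatrix']
      rw [h3, Matrix.mulVecLin_apply, Matrix.mulVec_mulVec, h]
      simp [Matrix.smul_mulVec]
    have h4 := mem_coordIdeal.mp (apply_mem_coordIdeal
      (LinearMap.toMatrix' f).adjugate.mulVecLin hb) i
    rw [← h2] at h4
    exact h4
  have h2 : minorIdeal (LinearMap.range f) ⊔ I ≤
      Submodule.comap (LinearMap.toSpanSingleton R R (b i)) I := by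
    refine sup_le (minorIdeal_le fun w hw => ?_) fun r hr => I.mul_mem_right _ hr
    choose c hc using hw
    have h3 : Matrix.of w = Matrix.of c * (LinearMap.toMatrix' f)ᵀ := by
      ext i j
      rw [Matrix.of_apply, ← hc i]
      have h3 : f (c i) = (LinearMap.toMatrix' f).mulVec (c i) := by
        rw [← Matrix.toLin'_apply, Matrix.toLin'_toMatrix']
      rw [h3, Matrix.mul_apply]
      simp [Matrix.mulVec, dotProduct, mul_comm]
    rw [h3, Matrix.det_mul, Matrix.det_transpose, LinearMap.det_toMatrix']
    change _ * LinearMap.det f * b i ∈ I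
    rw [mul_assoc]
    exact I.mul_mem_left _ h1
  exact h2 hr

/-- The projection `R^(q+1) → R^q` along a vector `w` whose first coordinate is `1`. -/
def projAlong {q : ℕ} (w : Fin (q + 1) → R) : (Fin (q + 1) → R) →ₗ[R] (Fin q → R) :=
  LinearMap.pi fun j => LinearMap.proj j.succ - w j.succ • LinearMap.proj 0

theorem projAlong_apply {q : ℕ} (w y : Fin (q + 1) → R) (j : Fin q) :
    projAlong w y j = y j.succ - w j.succ * y 0 := rfl

theorem projAlong_surjective {q : ℕ} (w : Fin (q + 1) → R) :
    Function.Surjective (projAlong w) := fun y =>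
  ⟨Fin.cons 0 y, by ext j; simp [projAlong_apply]⟩

theorem eq_smul_of_projAlong_eq_zero {q : ℕ} {w : Fin (q + 1) → R} (hw : w 0 = 1)
    (y : Fin (q + 1) → R) (hy : projAlong w y = 0) : y = y 0 • w := by
  ext j
  cases j using Fin.cases with
  | zero => simp [hw]
  | succ j =>
    have := congrFun hy j
    rw [projAlong_apply, Pi.zero_apply, sub_eq_zero] at this
    simp [this, mul_comm]

theorem comap_map_projAlong {q : ℕ} {w : Fin (q + 1) → R} (hw : w 0 = 1)
    {L : Submodule R (Fin (q + 1) → R)} (hL : w ∈ L) :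
    (L.map (projAlong w)).comap (projAlong w) = L := by
  rw [Submodule.comap_map_eq, sup_eq_left]
  intro y hy
  rw [eq_smul_of_projAlong_eq_zero hw y hy]
  exact L.smul_mem _ hL

theorem length_quotient_map_projAlong {q : ℕ} {w : Fin (q + 1) → R} (hw : w 0 = 1)
    {L : Submodule R (Fin (q + 1) → R)} (hL : w ∈ L) :
    Module.length R ((Fin (q + 1) → R) ⧸ L) =
      Module.length R ((Fin q → R) ⧸ L.map (projAlong w)) := by
  rw [length_quotient_comap (projAlong w) (L.map (projAlong w)), comap_map_projAlong hw hL]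
  have h : L.map (projAlong w) ⊔ LinearMap.range (projAlong w) = ⊤ := by
    rw [LinearMap.range_eq_top.mpr (projAlong_surjective w), sup_top_eq]
  have : Subsingleton ((Fin q → R) ⧸ (L.map (projAlong w) ⊔ LinearMap.range (projAlong w))) :=
    Submodule.Quotient.subsingleton_iff.mpr h
  simp

theorem det_eq_det_projAlong {q : ℕ} {w : Fin (q + 1) → R}
    (c : Fin (q + 1) → Fin (q + 1) → R) :
    (Matrix.of c).det =
      (Matrix.of fun i => (Fin.cons (c i 0) (projAlong w (c i)) : Fin (q + 1) → R)).det := by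
  rw [← Matrix.det_transpose, ← Matrix.det_transpose (Matrix.of fun i => _)]
  refine Matrix.det_eq_of_forall_row_eq_smul_add_const
    (Fin.cons 0 fun j => w j.succ) 0 rfl fun j i => ?_
  cases j using Fin.cases with
  | zero => simp
  | succ j => simp [projAlong_apply]

/-- Dividing out a vector of `M` with first coordinate `1` does not change the ideal of maximal
minors. -/
theorem minorIdeal_map_projAlong {q : ℕ} {w : Fin (q + 1) → R} (hw : w 0 = 1)
    {M : Submodule R (Fin (q + 1) → R)} (hM : w ∈ M) :
    minorIdeal (M.map (projAlong w)) = minorIdeal M := by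
  apply le_antisymm
  · refine minorIdeal_le fun b hb => ?_
    choose c hc hcb using hb
    have h : (Matrix.of b).det =
        (Matrix.of (Fin.cons w c : Fin (q + 1) → Fin (q + 1) → R)).det := by
      rw [det_eq_det_projAlong (w := w), Matrix.det_succ_row_zero, Fin.sum_univ_succ]
      have h0 : projAlong w w = 0 := by
        ext j
        simp [projAlong_apply, hw]
      have hb : Matrix.of b = (Matrix.of fun i => (Fin.cons
          ((Fin.cons w c : Fin (q + 1) → Fin (q + 1) → R) i 0)
          (projAlong w ((Fin.cons w c : Fin (q + 1) → Fin (q + 1) → R) i)) :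
            Fin (q + 1) → R)).submatrix Fin.succ (Fin.succAbove 0) := by
        ext i j
        simp [← hcb]
      rw [← hb]
      simp [h0, hw]
    rw [h]
    refine det_mem_minorIdeal fun i => ?_
    cases i using Fin.cases with
    | zero => exact hM
    | succ i => exact hc i
  · refine minorIdeal_le fun c hc => ?_
    rw [det_eq_det_projAlong (w := w), Matrix.det_succ_column_zero]
    refine Submodule.sum_mem _ fun i _ => Ideal.mul_mem_left _ _ ?_
    refine det_mem_minorIdeal (w := fun j => projAlong w (c (i.succAbove j))) fun j =>
      Submodule.mem_map_of_mem (hc _)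

end Minors

/-! ### Syzygies from Cramer's rule -/

section Syzygies

variable {R : Type*} [CommRing R] {E : Type*} [AddCommGroup E] [Module R E]

/-- The syzygy of `f : E → Rᵖ` that expresses, by Cramer's rule, `f e` through
`f c₁, …, f c_p`. -/
noncomputable def cramerSyzygy {p : ℕ} (f : E →ₗ[R] (Fin p → R)) (c : Fin p → E) (e : E) : E :=
  (Matrix.of fun i => f (c i)).det • e -
    ∑ i, Matrix.cramer (Matrix.of fun i => f (c i))ᵀ (f e) i • c i

/-- The submodule generated by all Cramer syzygies. -/
def cramerSyzygies {p : ℕ} (f : E →ₗ[R] (Fin p → R)) : Submodule R E :=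
  Submodule.span R {x | ∃ c e, cramerSyzygy f c e = x}

theorem apply_cramerSyzygy {p : ℕ} (f : E →ₗ[R] (Fin p → R)) (c : Fin p → E) (e : E) :
    f (cramerSyzygy f c e) = 0 := by
  simp only [cramerSyzygy, map_sub, map_smul, map_sum]
  rw [sum_cramer_smul (fun i => f (c i)) (f e), sub_self]

theorem apply_eq_zero_of_mem_cramerSyzygies {p : ℕ} {f : E →ₗ[R] (Fin p → R)} {x : E}
    (hx : x ∈ cramerSyzygies f) : f x = 0 := by
  have h : cramerSyzygies f ≤ LinearMap.ker f :=
    Submodule.span_le.mpr fun _ ⟨c, e, h⟩ => h ▸ apply_cramerSyzygy f c e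
  exact h hx

theorem map_cramerSyzygies_le {p : ℕ} {E' : Type*} [AddCommGroup E'] [Module R E']
    (f : E →ₗ[R] (Fin p → R)) (g : E' →ₗ[R] E) :
    (cramerSyzygies (f ∘ₗ g)).map g ≤ cramerSyzygies f := by
  rw [Submodule.map_le_iff_le_comap]
  refine Submodule.span_le.mpr ?_
  rintro _ ⟨c, e, rfl⟩
  refine Submodule.subset_span ⟨fun i => g (c i), g e, ?_⟩
  simp [cramerSyzygy]

end Syzygies

/-! ### Maximal minors and finite colength -/

section LocalMinors

variable {R : Type*} [CommRing R] [IsLocalRing R]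

/-- A product of `p` elements of `𝔪ⁿ` is the determinant of a diagonal matrix with rows in `M`. -/
theorem Cofinite.exists_pow_le_minorIdeal {p : ℕ} {M : Submodule R (Fin p → R)} {I : Ideal R}
    (h : Cofinite (M ⊔ coordIdeal _ I)) : ∃ n, maximalIdeal R ^ n ≤ minorIdeal M ⊔ I := by
  obtain ⟨n, hn⟩ := h
  refine ⟨n * p, ?_⟩
  rw [pow_mul, Submodule.pow_eq_span_pow_set, Submodule.span_le]
  intro x hx
  obtain ⟨r, rfl⟩ := Set.mem_pow.mp hx
  have h1 : (List.ofFn fun i => (r i : R)).prod = (Matrix.diagonal fun i => (r i : R)).det := by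
    rw [Matrix.det_diagonal, List.prod_ofFn]
  rw [h1]
  refine det_mem_minorIdeal_sup (w := fun i => Matrix.diagonal (fun i => (r i : R)) i) fun i => ?_
  refine hn (mem_coordIdeal.mpr fun j => ?_)
  by_cases hij : i = j
  · subst hij
    rw [Matrix.diagonal_apply_eq]
    exact (r i).2
  · rw [Matrix.diagonal_apply_ne _ hij]
    exact zero_mem _

theorem cofinite_of_pow_le_minorIdeal {p : ℕ} {M : Submodule R (Fin p → R)} {I : Ideal R} {n : ℕ}
    (h : maximalIdeal R ^ n ≤ minorIdeal M ⊔ I) : Cofinite (M ⊔ coordIdeal _ I) := by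
  refine ⟨n, fun y hy => ?_⟩
  rw [pi_eq_sum_univ' y]
  exact Submodule.sum_mem _ fun i _ =>
    smul_mem_of_mem_minorIdeal_sup (h (mem_coordIdeal.mp hy i)) _

end LocalMinors

/-! ### Exchange of a column -/

section Exchange

variable {R : Type*} [CommRing R]

theorem add_eq_add_of_add_eq_add {a b c d A B : ℕ∞} (hA : A ≠ ⊤) (h1 : B + b = A + a)
    (h2 : d + B = c + A) : a + d = b + c := by
  refine WithTop.add_left_cancel hA ?_
  calc A + (a + d) = (A + a) + d := (add_assoc _ _ _).symm
    _ = b + (d + B) := by rw [← h1, add_comm B b, add_assoc, add_comm B d]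
    _ = A + (b + c) := by rw [h2, add_comm A, add_assoc]

theorem sup_span_singleton_pow_le (J : Ideal R) (u : R) (k : ℕ) :
    (J ⊔ Ideal.span {u}) ^ k ≤ J ⊔ Ideal.span {u ^ k} := by
  induction k with
  | zero => simp
  | succ k ih =>
    rw [pow_succ]
    refine (Ideal.mul_mono ih le_rfl).trans ?_
    rw [Ideal.sup_mul, Ideal.mul_sup (Ideal.span {u ^ k}), Ideal.span_singleton_mul_span_singleton,
      ← pow_succ]
    exact sup_le (Ideal.mul_le_left.trans le_sup_left)
      (sup_le (Ideal.mul_le_right.trans le_sup_left) le_sup_right)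

/-- A maximal minor of `M + (v)` is the value at `v` of a minor functional, modulo the minors
of `M`. -/
theorem exists_minorFunctional {q : ℕ} {M : Submodule R (Fin (q + 1) → R)} {I : Ideal R}
    {v : Fin (q + 1) → R} {r : R} (hr : r ∈ minorIdeal (M ⊔ Submodule.span R {v}) ⊔ I) :
    ∃ φ ∈ minorFunctionals M, r - φ v ∈ minorIdeal M ⊔ I := by
  rw [minorIdeal_sup_span_singleton, sup_right_comm] at hr
  obtain ⟨a, ha, _, ⟨φ, hφ, rfl⟩, rfl⟩ := Submodule.mem_sup.mp hr
  exact ⟨φ, hφ, by simpa using ha⟩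

theorem mul_mem_of_forall_minorFunctional {q : ℕ} {M : Submodule R (Fin (q + 1) → R)} {I : Ideal R}
    {v : Fin (q + 1) → R} {y : R}
    (hy : ∀ φ ∈ minorFunctionals M, y * φ v ∈ minorIdeal M ⊔ I) {r : R}
    (hr : r ∈ minorIdeal (M ⊔ Submodule.span R {v}) ⊔ I) : y * r ∈ minorIdeal M ⊔ I := by
  obtain ⟨φ, hφ, h⟩ := exists_minorFunctional hr
  have := add_mem (Ideal.mul_mem_left _ y h) (hy φ hφ)
  rwa [← mul_add, sub_add_cancel] at this

variable [IsLocalRing R]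

/-- If some parameter is regular modulo the maximal minors of `M`, then these minors are exactly
the elements that multiply `x` into `M`, for any `x` that together with `M` generates a submodule
of finite colength. -/
theorem smul_mem_iff_mem_minorIdeal {q : ℕ} {M : Submodule R (Fin (q + 1) → R)} {I : Ideal R}
    {u : R} (hum : u ∈ maximalIdeal R)
    (hu : ∀ y, u * y ∈ minorIdeal M ⊔ I → y ∈ minorIdeal M ⊔ I) {x : Fin (q + 1) → R}
    (hx : Cofinite (M ⊔ Submodule.span R {x} ⊔ coordIdeal _ I)) (r : R) :
    r • x ∈ M ⊔ coordIdeal _ I ↔ r ∈ minorIdeal M ⊔ I := by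
  refine ⟨fun hr => ?_, fun hr => smul_mem_of_mem_minorIdeal_sup hr x⟩
  obtain ⟨k, hk⟩ := hx.exists_pow_le_minorIdeal
  have h1 : r * u ^ k ∈ minorIdeal M ⊔ I := by
    refine mul_mem_of_forall_minorFunctional (fun φ hφ => ?_) (hk (Ideal.pow_mem_pow hum k))
    have := minorFunctional_apply_mem_sup hφ hr
    rwa [map_smul] at this
  exact regular_mod_pow hu k r (by rwa [mul_comm])

theorem length_quotient_sup_span_smul {q : ℕ} {M : Submodule R (Fin (q + 1) → R)} {I : Ideal R}
    {u : R} (hum : u ∈ maximalIdeal R)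
    (hu : ∀ y, u * y ∈ minorIdeal M ⊔ I → y ∈ minorIdeal M ⊔ I) {x : Fin (q + 1) → R}
    (hx : Cofinite (M ⊔ Submodule.span R {x} ⊔ coordIdeal _ I)) (a : R) :
    Module.length R ((Fin (q + 1) → R) ⧸ (M ⊔ coordIdeal _ I ⊔ Submodule.span R {a • x})) =
      Module.length R (R ⧸ (minorIdeal M ⊔ I ⊔ Ideal.span {a})) +
      Module.length R ((Fin (q + 1) → R) ⧸ (M ⊔ Submodule.span R {x} ⊔ coordIdeal _ I)) := by
  rw [length_quotient_span_singleton _ x (minorIdeal M ⊔ I ⊔ Ideal.span {a})]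
  · have h : M ⊔ coordIdeal _ I ⊔ Submodule.span R {a • x} ⊔ Submodule.span R {x} =
        M ⊔ Submodule.span R {x} ⊔ coordIdeal _ I := by
      have h1 : Submodule.span R {a • x} ≤ Submodule.span R {x} :=
        (Submodule.span_singleton_le_iff_mem _ _).mpr
          (Submodule.smul_mem _ _ (Submodule.mem_span_singleton_self x))
      rw [sup_assoc, sup_eq_right.mpr h1, sup_right_comm]
    rw [h]
  · intro r
    rw [mem_sup_span_singleton]
    constructor
    · intro hr
      obtain ⟨l, hl, z, hz, e⟩ := Submodule.mem_sup.mp hr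
      obtain ⟨c, rfl⟩ := Submodule.mem_span_singleton.mp hz
      refine ⟨c, (smul_mem_iff_mem_minorIdeal hum hu hx _).mp ?_⟩
      rw [sub_smul, ← e, smul_smul, mul_comm c a, add_sub_cancel_right]
      exact hl
    · rintro ⟨c, hc⟩
      have := (smul_mem_iff_mem_minorIdeal hum hu hx _).mpr hc
      rw [sub_smul] at this
      rw [← sub_add_cancel (r • x) (c • a • x)]
      exact Submodule.add_mem_sup (by rwa [smul_smul, mul_comm c a])
        (Submodule.smul_mem _ _ (Submodule.mem_span_singleton_self _))

omit [IsLocalRing R] in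
theorem length_quotient_sup_span_mul {J K : Ideal R} (hJK : J ≤ K) {a : R}
    (ha : ∀ y, a * y ∈ J → y ∈ J) :
    Module.length R (R ⧸ (J ⊔ Ideal.span {a} * K)) =
      Module.length R (R ⧸ K) + Module.length R (R ⧸ (J ⊔ Ideal.span {a})) := by
  rw [length_quotient_span_singleton (J ⊔ Ideal.span {a} * K) a K]
  · have h : J ⊔ Ideal.span {a} * K ⊔ Submodule.span R {a} = J ⊔ Ideal.span {a} := by
      rw [sup_assoc]
      congr 1
      exact sup_eq_right.mpr Ideal.mul_le_left
    rw [h]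
  · intro r
    rw [smul_eq_mul, Submodule.mem_sup]
    constructor
    · rintro ⟨j, hj, z, hz, e⟩
      obtain ⟨s, hs, rfl⟩ := Ideal.mem_span_singleton_mul.mp hz
      have : a * (r - s) ∈ J := by
        convert hj using 1
        linear_combination -e
      have := K.add_mem (hJK (ha _ this)) hs
      simpa using this
    · exact fun hr => ⟨0, zero_mem _, a * r, Ideal.mem_span_singleton_mul.mpr ⟨r, hr, rfl⟩, by ring⟩

omit [IsLocalRing R] in
theorem span_mul_minorIdeal_le {q : ℕ} {M : Submodule R (Fin (q + 1) → R)} {I : Ideal R}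
    {v w : Fin (q + 1) → R} {φ : (Fin (q + 1) → R) →ₗ[R] R} (hφ : φ ∈ minorFunctionals M) :
    Ideal.span {φ w} * (minorIdeal (M ⊔ Submodule.span R {v}) ⊔ I) ≤
      minorIdeal M ⊔ I ⊔ Ideal.span {φ v} * (minorIdeal (M ⊔ Submodule.span R {w}) ⊔ I) := by
  rw [Ideal.span_singleton_mul_le_iff]
  intro s hs
  obtain ⟨ψ, hψ, h⟩ := exists_minorFunctional hs
  have h1 : φ w * ψ v - φ v * ψ w ∈ minorIdeal M ⊔ I := by
    have := minorFunctional_apply_mem_sup (I := I) hψ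
      (Submodule.mem_sup_left (minorFunctional_smul_sub_mem hφ w v))
    simpa using this
  have h2 : φ v * ψ w ∈ Ideal.span {φ v} * (minorIdeal (M ⊔ Submodule.span R {w}) ⊔ I) :=
    Ideal.mul_mem_mul (Ideal.mem_span_singleton_self _) (Submodule.mem_sup_left
      (minorFunctional_apply_mem hψ le_sup_left
        (Submodule.mem_sup_right (Submodule.mem_span_singleton_self w))))
  have h3 := add_mem (Ideal.mul_mem_left _ (φ w) h) h1
  convert Submodule.add_mem_sup h3 h2 using 1
  ring

/-- The difference of the colengths of a submodule and of its ideal of maximal minors does not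
change when one generator `v` is replaced by another vector `w`. The reason is that
`φ v • w ≡ φ w • v` modulo the other generators, for the functionals `φ` given by their minors,
and that multiplication by `φ v` and by `φ w` changes both colengths in the same way. -/
theorem length_exchange [IsNoetherianRing R] {q : ℕ} {M : Submodule R (Fin (q + 1) → R)}
    {I : Ideal R} {u : R} (hum : u ∈ maximalIdeal R)
    (hu : ∀ y, u * y ∈ minorIdeal M ⊔ I → y ∈ minorIdeal M ⊔ I) {n : ℕ}
    (hn : maximalIdeal R ^ n ≤ minorIdeal M ⊔ I ⊔ Ideal.span {u}) {v w : Fin (q + 1) → R}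
    (hv : Cofinite (M ⊔ Submodule.span R {v} ⊔ coordIdeal _ I))
    (hw : Cofinite (M ⊔ Submodule.span R {w} ⊔ coordIdeal _ I)) :
    Module.length R ((Fin (q + 1) → R) ⧸ (M ⊔ Submodule.span R {v} ⊔ coordIdeal _ I)) +
      Module.length R (R ⧸ (minorIdeal (M ⊔ Submodule.span R {w}) ⊔ I)) =
    Module.length R ((Fin (q + 1) → R) ⧸ (M ⊔ Submodule.span R {w} ⊔ coordIdeal _ I)) +
      Module.length R (R ⧸ (minorIdeal (M ⊔ Submodule.span R {v}) ⊔ I)) := by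
  obtain ⟨k, hk⟩ := hv.exists_pow_le_minorIdeal
  obtain ⟨l, hl⟩ := hw.exists_pow_le_minorIdeal
  obtain ⟨φ, hφ, hφv⟩ := exists_minorFunctional (hk (Ideal.pow_mem_pow hum k))
  have hJ : ∀ x, minorIdeal M ⊔ I ≤ minorIdeal (M ⊔ Submodule.span R {x}) ⊔ I := fun x =>
    sup_le_sup_right (minorIdeal_mono le_sup_left) I
  -- `φ v` agrees with `u ^ k` modulo the minors of `M`, so it is regular there.
  have hU : ∀ y, φ v * y ∈ minorIdeal M ⊔ I → y ∈ minorIdeal M ⊔ I := fun y hy =>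
    regular_mod_pow hu k y (by
      have := add_mem (Ideal.mul_mem_right y _ hφv) hy
      rwa [← add_mul, sub_add_cancel] at this)
  -- Multiplying by `φ w` amounts to multiplying by `φ v` after exchanging `v` for `w`.
  have ha : ∀ y, φ w * y ∈ minorIdeal M ⊔ I → y ∈ minorIdeal M ⊔ I := by
    intro y hy
    refine regular_mod_pow hu l y ?_
    rw [mul_comm]
    refine mul_mem_of_forall_minorFunctional (fun ψ hψ => hU _ ?_) (hl (Ideal.pow_mem_pow hum l))
    have h1 := minorFunctional_apply_mem_sup (I := I) hψ
      (Submodule.mem_sup_left (minorFunctional_smul_sub_mem hφ v w))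
    have h2 := add_mem (Ideal.mul_mem_left _ y h1) (Ideal.mul_mem_left _ (ψ v) hy)
    convert h2 using 1
    simp only [map_sub, map_smul, smul_eq_mul]
    ring
  have hspan : M ⊔ coordIdeal _ I ⊔ Submodule.span R {φ w • v} =
      M ⊔ coordIdeal _ I ⊔ Submodule.span R {φ v • w} := by
    have key : ∀ x y : Fin (q + 1) → R, M ⊔ coordIdeal _ I ⊔ Submodule.span R {φ y • x} ≤
        M ⊔ coordIdeal _ I ⊔ Submodule.span R {φ x • y} := by
      intro x y
      refine sup_le le_sup_left ((Submodule.span_singleton_le_iff_mem _ _).mpr ?_)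
      rw [← sub_add_cancel (φ y • x) (φ x • y)]
      exact Submodule.add_mem_sup
        (Submodule.mem_sup_left (minorFunctional_smul_sub_mem hφ y x))
        (Submodule.mem_span_singleton_self _)
    exact le_antisymm (key v w) (key w v)
  have h1 := length_quotient_sup_span_smul hum hu hv (φ w)
  rw [hspan, length_quotient_sup_span_smul hum hu hw (φ v)] at h1
  have hmul : minorIdeal M ⊔ I ⊔ Ideal.span {φ w} * (minorIdeal (M ⊔ Submodule.span R {v}) ⊔ I) =
      minorIdeal M ⊔ I ⊔ Ideal.span {φ v} * (minorIdeal (M ⊔ Submodule.span R {w}) ⊔ I) :=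
    le_antisymm (sup_le le_sup_left (span_mul_minorIdeal_le hφ))
      (sup_le le_sup_left (span_mul_minorIdeal_le hφ))
  have h2 := length_quotient_sup_span_mul (hJ v) ha
  rw [hmul, length_quotient_sup_span_mul (hJ w) hU] at h2
  have hUfin : Module.length R (R ⧸ (minorIdeal M ⊔ I ⊔ Ideal.span {φ v})) ≠ ⊤ := by
    refine length_quotient_ne_top (n := n * k) ?_
    rw [pow_mul]
    refine (Ideal.pow_right_mono hn k).trans ((sup_span_singleton_pow_le _ _ _).trans ?_)
    refine sup_le le_sup_left ((Ideal.span_singleton_le_iff_mem _).mpr ?_)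
    rw [← sub_add_cancel (u ^ k) (φ v)]
    exact Submodule.add_mem_sup hφv (Ideal.mem_span_singleton_self _)
  have hafin : Module.length R (R ⧸ (minorIdeal M ⊔ I ⊔ Ideal.span {φ w})) ≠ ⊤ := by
    have : Module.length R (R ⧸ (minorIdeal M ⊔ I ⊔ Ideal.span {φ w})) +
        Module.length R ((Fin (q + 1) → R) ⧸ (M ⊔ Submodule.span R {v} ⊔ coordIdeal _ I)) ≠ ⊤ := by
      rw [← h1]
      exact WithTop.add_ne_top.mpr ⟨hUfin, hw.length_ne_top⟩
    exact (WithTop.add_ne_top.mp this).1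
  exact add_eq_add_of_add_eq_add hafin h1 h2

end Exchange

/-! ### Regularity and lifting of syzygies -/

section Depth

variable {R : Type*} [CommRing R]

theorem mem_coordIdeal_sup_span_singleton {ι : Type*} {I : Ideal R} {x : R} {y : ι → R} :
    y ∈ coordIdeal ι (I ⊔ Ideal.span {x}) ↔ ∃ c, y - x • c ∈ coordIdeal ι I := by
  simp only [mem_coordIdeal, mem_sup_span_singleton, Classical.skolem]
  rfl

/-- If every syzygy of `f` modulo `(I, u)` is a Cramer syzygy, it lifts to a syzygy modulo `I`;
so `u` is regular on the cokernel of `f` modulo `I`. -/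
theorem regular_coker_of_syzygies {ι : Type*} [Fintype ι] {p : ℕ} {I : Ideal R} {u : R}
    (f : (ι → R) →ₗ[R] (Fin p → R)) (hu : ∀ y, u * y ∈ I → y ∈ I)
    (hsyz : ∀ b, f b ∈ coordIdeal _ (I ⊔ Ideal.span {u}) →
      b ∈ cramerSyzygies f ⊔ coordIdeal _ (I ⊔ Ideal.span {u})) (y : Fin p → R)
    (hy : u • y ∈ LinearMap.range f ⊔ coordIdeal _ I) : y ∈ LinearMap.range f ⊔ coordIdeal _ I := by
  obtain ⟨_, ⟨b, rfl⟩, z, hz, e⟩ := Submodule.mem_sup.mp hy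
  have h1 : f b ∈ coordIdeal _ (I ⊔ Ideal.span {u}) := by
    refine mem_coordIdeal_sup_span_singleton.mpr ⟨y, ?_⟩
    rw [← e, sub_add_cancel_left]
    exact neg_mem hz
  obtain ⟨s, hs, t, ht, rfl⟩ := Submodule.mem_sup.mp (hsyz b h1)
  obtain ⟨c, hc⟩ := mem_coordIdeal_sup_span_singleton.mp ht
  have h2 := apply_mem_coordIdeal f hc
  rw [map_add, apply_eq_zero_of_mem_cramerSyzygies hs, zero_add] at e
  rw [map_sub, map_smul] at h2
  have h3 : y - f c ∈ coordIdeal _ I := by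
    rw [mem_coordIdeal]
    intro i
    refine hu _ ?_
    have := mem_coordIdeal.mp (add_mem hz h2) i
    convert this using 1
    have := congrFun e i
    simp only [Pi.add_apply, Pi.smul_apply, smul_eq_mul, Pi.sub_apply] at this ⊢
    linear_combination -this
  rw [← sub_add_cancel y (f c), add_comm]
  exact Submodule.add_mem_sup ⟨c, rfl⟩ h3

/-- The colength modulo `uᵏ` is linear in `k` if `u` is regular on the cokernel. -/
theorem length_quotient_pow_succ {p : ℕ} {I : Ideal R} {u : R} {M : Submodule R (Fin p → R)}
    (hu : ∀ y, u • y ∈ M ⊔ coordIdeal _ I → y ∈ M ⊔ coordIdeal _ I) (k : ℕ) :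
    Module.length R ((Fin p → R) ⧸ (M ⊔ coordIdeal _ (I ⊔ Ideal.span {u ^ (k + 1)}))) =
      Module.length R ((Fin p → R) ⧸ (M ⊔ coordIdeal _ (I ⊔ Ideal.span {u ^ k}))) +
      Module.length R ((Fin p → R) ⧸ (M ⊔ coordIdeal _ (I ⊔ Ideal.span {u}))) := by
  have mem : ∀ (x : R) (y : Fin p → R), y ∈ M ⊔ coordIdeal _ (I ⊔ Ideal.span {x}) ↔
      ∃ c, y - x • c ∈ M ⊔ coordIdeal _ I := by
    intro x y
    constructor
    · intro hy
      obtain ⟨m, hm, z, hz, rfl⟩ := Submodule.mem_sup.mp hy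
      obtain ⟨c, hc⟩ := mem_coordIdeal_sup_span_singleton.mp hz
      exact ⟨c, by rw [add_sub_assoc]; exact Submodule.add_mem_sup hm hc⟩
    · rintro ⟨c, hc⟩
      rw [← sub_add_cancel y (x • c)]
      refine add_mem (sup_le_sup_left (coordIdeal_mono le_sup_left) M hc)
        (Submodule.mem_sup_right (mem_coordIdeal_sup_span_singleton.mpr ⟨c, by simp⟩))
  have h1 : (M ⊔ coordIdeal _ (I ⊔ Ideal.span {u ^ (k + 1)})).comap
      (LinearMap.lsmul R (Fin p → R) u) = M ⊔ coordIdeal _ (I ⊔ Ideal.span {u ^ k}) := by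
    ext y
    rw [Submodule.mem_comap, LinearMap.lsmul_apply, mem, mem]
    refine exists_congr fun c => ?_
    rw [pow_succ', mul_smul, ← smul_sub]
    exact ⟨hu _, Submodule.smul_mem _ u⟩
  have h2 : M ⊔ coordIdeal _ (I ⊔ Ideal.span {u ^ (k + 1)}) ⊔
      LinearMap.range (LinearMap.lsmul R (Fin p → R) u) =
      M ⊔ coordIdeal _ (I ⊔ Ideal.span {u}) := by
    ext y
    rw [mem, Submodule.mem_sup]
    constructor
    · rintro ⟨a, ha, _, ⟨b, rfl⟩, rfl⟩
      obtain ⟨c, hc⟩ := (mem _ _).mp ha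
      refine ⟨u ^ k • c + b, ?_⟩
      convert hc using 1
      rw [LinearMap.lsmul_apply, smul_add, smul_smul, ← pow_succ']
      abel
    · rintro ⟨c, hc⟩
      exact ⟨_, sup_le_sup_left (coordIdeal_mono le_sup_left) M hc, _, ⟨c, rfl⟩,
        sub_add_cancel _ _⟩
  rw [length_quotient_comap (LinearMap.lsmul R (Fin p → R) u), h1, h2]

variable [IsLocalRing R] [IsNoetherianRing R]

/-- If the colength of `(J, uᵏ)` grows linearly in `k`, then `u` is regular modulo `J`. -/
theorem regular_of_length_pow {J : Ideal R} {u : R} (hum : u ∈ maximalIdeal R)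
    (hfin : ∀ k, Module.length R (R ⧸ (J ⊔ Ideal.span {u ^ k})) ≠ ⊤)
    (hlen : ∀ k, Module.length R (R ⧸ (J ⊔ Ideal.span {u ^ (k + 1)})) =
      Module.length R (R ⧸ (J ⊔ Ideal.span {u ^ k})) +
      Module.length R (R ⧸ (J ⊔ Ideal.span {u}))) (y : R) (hy : u * y ∈ J) : y ∈ J := by
  refine mem_of_pow_le fun k => ?_
  suffices h : y ∈ J ⊔ Ideal.span {u ^ k} from
    sup_le_sup_left ((Ideal.span_singleton_le_iff_mem _).mpr (Ideal.pow_mem_pow hum k)) J h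
  have h1 := length_quotient_comap (LinearMap.toSpanSingleton R R u)
    (J ⊔ Ideal.span {u ^ (k + 1)})
  set B := Submodule.comap (LinearMap.toSpanSingleton R R u) (J ⊔ Ideal.span {u ^ (k + 1)}) with hB
  have hr : J ⊔ Ideal.span {u ^ (k + 1)} ⊔ LinearMap.range (LinearMap.toSpanSingleton R R u) =
      J ⊔ Ideal.span {u} := by
    rw [LinearMap.range_toSpanSingleton, sup_assoc]
    congr 1
    refine sup_eq_right.mpr ?_
    exact (Ideal.span_singleton_le_iff_mem _).mpr
      (Ideal.mem_span_singleton.mpr (dvd_pow_self u k.succ_ne_zero))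
  rw [hr, hlen] at h1
  have h2 := WithTop.add_right_cancel (by have := hfin 1; rwa [pow_one] at this) h1
  have hAB : J ⊔ Ideal.span {u ^ k} ≤ B := by
    intro z hz
    obtain ⟨c, hc⟩ := mem_sup_span_singleton.mp hz
    rw [hB, Submodule.mem_comap, LinearMap.toSpanSingleton_apply, smul_eq_mul]
    refine mem_sup_span_singleton.mpr ⟨c, ?_⟩
    convert J.mul_mem_left u hc using 1
    ring
  have hyB : y ∈ B := by
    rw [hB, Submodule.mem_comap, LinearMap.toSpanSingleton_apply, smul_eq_mul, mul_comm]
    exact Submodule.mem_sup_left hy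
  -- The ideals `(J, uᵏ) ⊆ ((J, uᵏ⁺¹) : u)` have the same finite colength, so they agree.
  let C : Ideal R := Submodule.comap (LinearMap.toSpanSingleton R R y) (J ⊔ Ideal.span {u ^ k})
  have h3 := length_quotient_span_singleton (J ⊔ Ideal.span {u ^ k}) y C fun r => by
    simp [C]
  have hle : J ⊔ Ideal.span {u ^ k} ⊔ Submodule.span R {y} ≤ B :=
    sup_le hAB ((Submodule.span_singleton_le_iff_mem _ _).mpr hyB)
  have h4 := Module.length_le_of_surjective (Submodule.factor hle)
    (Submodule.factor_surjective hle)
  rw [← h2] at h4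
  have h5 : Module.length R (R ⧸ C) = 0 := by
    have hf := hfin k
    rw [h3] at h4 hf
    obtain ⟨ha, hb⟩ := WithTop.add_ne_top.mp hf
    generalize Module.length R (R ⧸ C) = a at *
    generalize Module.length R (R ⧸ (J ⊔ Ideal.span {u ^ k} ⊔ Submodule.span R {y})) = b at *
    lift a to ℕ using ha
    lift b to ℕ using hb
    norm_cast at h4 ⊢
    omega
  have h6 : C = ⊤ := by
    rw [Module.length_eq_zero_iff] at h5
    exact Ideal.Quotient.subsingleton_iff.mp h5
  have h7 : (1 : R) ∈ C := h6 ▸ Submodule.mem_top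
  simpa [C] using h7

/-- Lifting Cramer syzygies from `(I, u)` to `I`, by Nakayama's lemma. -/
theorem mem_cramerSyzygies_of_regular {ι : Type*} [Finite ι] {p : ℕ} {I : Ideal R} {u : R}
    (hum : u ∈ maximalIdeal R) (f : (ι → R) →ₗ[R] (Fin p → R)) (hu : ∀ y, u * y ∈ I → y ∈ I)
    (hsyz : ∀ b, f b ∈ coordIdeal _ (I ⊔ Ideal.span {u}) →
      b ∈ cramerSyzygies f ⊔ coordIdeal _ (I ⊔ Ideal.span {u})) (b : ι → R)
    (hb : f b ∈ coordIdeal _ I) : b ∈ cramerSyzygies f ⊔ coordIdeal _ I := by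
  have := Fintype.ofFinite ι
  let N : Submodule R (ι → R) := (coordIdeal _ I).comap f
  suffices h : N ≤ cramerSyzygies f ⊔ coordIdeal _ I from h hb
  refine Submodule.le_of_le_smul_of_le_jacobson_bot (I := Ideal.span {u})
    (IsNoetherian.noetherian N) ?_ fun b hb => ?_
  · refine le_trans ?_ (maximalIdeal_le_jacobson ⊥)
    exact (Ideal.span_singleton_le_iff_mem _).mpr hum
  · obtain ⟨s, hs, t, ht, rfl⟩ := Submodule.mem_sup.mp
      (hsyz b (coordIdeal_mono le_sup_left hb))
    obtain ⟨c, hc⟩ := mem_coordIdeal_sup_span_singleton.mp ht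
    have h2 := apply_mem_coordIdeal f hc
    have hb' : f t ∈ coordIdeal _ I := by
      have : f (s + t) ∈ coordIdeal _ I := hb
      rwa [map_add, apply_eq_zero_of_mem_cramerSyzygies hs, zero_add] at this
    have hcN : c ∈ N := by
      refine mem_coordIdeal.mpr fun i => hu _ ?_
      have := mem_coordIdeal.mp (sub_mem hb' h2) i
      convert this using 1
      simp
    rw [← sub_add_cancel t (u • c), ← add_assoc]
    exact Submodule.add_mem_sup (Submodule.add_mem_sup hs hc)
      (Submodule.smul_mem_smul (Ideal.mem_span_singleton_self u) hcN)

omit [IsNoetherianRing R] in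
/-- Passage of Cramer syzygies from the matrix without its first column to the whole matrix: the
first coordinate of a syzygy is a combination of minors of the other columns. -/
theorem mem_cramerSyzygies_of_tail {n q : ℕ} {I : Ideal R} {u : R} (hum : u ∈ maximalIdeal R)
    (f : (Fin (n + 1) → R) →ₗ[R] (Fin (q + 1) → R)) (g : (Fin n → R) →ₗ[R] (Fin (n + 1) → R))
    (hg : ∀ b, g b = Fin.cons 0 b)
    (hf : Cofinite (LinearMap.range (f ∘ₗ g) ⊔ Submodule.span R {f (Pi.single 0 1)} ⊔
      coordIdeal _ I))
    (hu : ∀ y, u * y ∈ minorIdeal (LinearMap.range (f ∘ₗ g)) ⊔ I →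
      y ∈ minorIdeal (LinearMap.range (f ∘ₗ g)) ⊔ I)
    (hsyz : ∀ b, (f ∘ₗ g) b ∈ coordIdeal _ I → b ∈ cramerSyzygies (f ∘ₗ g) ⊔ coordIdeal _ I)
    (b : Fin (n + 1) → R) (hb : f b ∈ coordIdeal _ I) :
    b ∈ cramerSyzygies f ⊔ coordIdeal _ I := by
  have decomp : ∀ b : Fin (n + 1) → R, b = b 0 • Pi.single 0 1 + g (Fin.tail b) := by
    intro b
    rw [hg]
    ext i
    cases i using Fin.cases with
    | zero => simp
    | succ i => simp [Fin.tail]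
  have h1 : b 0 ∈ minorIdeal (LinearMap.range (f ∘ₗ g)) ⊔ I := by
    rw [← smul_mem_iff_mem_minorIdeal hum hu hf]
    have h := congrArg f (decomp b)
    rw [map_add, map_smul] at h
    rw [← sub_eq_of_eq_add h]
    exact sub_mem (Submodule.mem_sup_right hb) (Submodule.mem_sup_left ⟨Fin.tail b, rfl⟩)
  have h2 : minorIdeal (LinearMap.range (f ∘ₗ g)) ≤ (cramerSyzygies f).map (LinearMap.proj 0) := by
    refine minorIdeal_le fun w hw => ?_
    choose c hc using hw
    refine ⟨cramerSyzygy f (fun i => g (c i)) (Pi.single 0 1), Submodule.subset_span ⟨_, _, rfl⟩, ?_⟩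
    have : (fun i => f (g (c i))) = w := funext hc
    simp [cramerSyzygy, hg, ← this]
  obtain ⟨r, hr, i, hi, hri⟩ := Submodule.mem_sup.mp h1
  obtain ⟨s, hs, rfl⟩ := h2 hr
  have h3 : (b - s) 0 ∈ I := by
    rw [Pi.sub_apply, ← hri]
    simpa using hi
  have h4 : f (b - s) ∈ coordIdeal _ I := by
    rwa [map_sub, apply_eq_zero_of_mem_cramerSyzygies hs, sub_zero]
  have h5 : (f ∘ₗ g) (Fin.tail (b - s)) ∈ coordIdeal _ I := by
    have h := congrArg f (decomp (b - s))
    rw [map_add, map_smul] at h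
    rw [LinearMap.comp_apply, ← sub_eq_of_eq_add' h]
    exact sub_mem h4 (mem_coordIdeal.mpr fun i => I.mul_mem_right _ h3)
  have h6 : g (Fin.tail (b - s)) ∈ cramerSyzygies f ⊔ coordIdeal _ I := by
    obtain ⟨x, hx, y, hy, e⟩ := Submodule.mem_sup.mp (hsyz _ h5)
    rw [← e, map_add]
    exact Submodule.add_mem_sup (map_cramerSyzygies_le f g ⟨x, hx, rfl⟩)
      (apply_mem_coordIdeal g hy)
  rw [← sub_add_cancel b s]
  refine add_mem ?_ (Submodule.mem_sup_left hs)
  rw [decomp (b - s)]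
  exact add_mem (Submodule.mem_sup_right (mem_coordIdeal.mpr fun i => I.mul_mem_right _ h3)) h6

end Depth

/-! ### General position -/

section GeneralPosition

/-- For a submodule with given generators, the minors of the generators suffice. -/
theorem minorIdeal_span_range {R ι : Type*} [CommRing R] [Finite ι] {p : ℕ}
    (a : ι → Fin p → R) : minorIdeal (Submodule.span R (Set.range a)) =
      Ideal.span (Set.range fun s : Fin p → ι => (Matrix.of fun i => a (s i)).det) := by
  classical
  have := Fintype.ofFinite ι
  apply le_antisymm
  · refine minorIdeal_le fun w hw => ?_
    have hw' : ∀ i, ∃ x : ι → R, ∑ j, x j • a j = w i := fun i =>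
      (Submodule.mem_span_range_iff_exists_fun R).mp (hw i)
    choose x hx using hw'
    have h1 : Matrix.of w = fun i => ∑ j, x i j • a j := funext fun i => (hx i).symm
    rw [h1]
    have h2 := (Matrix.detRowAlternating (n := Fin p) (R := R)).toMultilinearMap.map_sum
      (α := fun _ => ι) (fun i j => x i j • a j)
    change Matrix.det (fun i => ∑ j, x i j • a j) = _ at h2
    rw [h2]
    refine Submodule.sum_mem _ fun s _ => ?_
    rw [MultilinearMap.map_smul_univ]
    exact Submodule.smul_mem _ _ (Ideal.subset_span ⟨s, rfl⟩)
  · rw [Ideal.span_le]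
    rintro _ ⟨s, rfl⟩
    exact det_mem_minorIdeal fun i => Submodule.subset_span ⟨s i, rfl⟩

theorem minorIdeal_span_range_map {R S ι : Type*} [CommRing R] [CommRing S] [Finite ι] {p : ℕ}
    (φ : R →+* S) (a : ι → Fin p → R) :
    minorIdeal (Submodule.span S (Set.range fun i j => φ (a i j))) =
      (minorIdeal (Submodule.span R (Set.range a))).map φ := by
  rw [minorIdeal_span_range, minorIdeal_span_range, Ideal.map_span, ← Set.range_comp]
  congr 2
  ext1 s
  rw [Function.comp_apply, RingHom.map_det]
  rfl

/-- A vector space over an infinite field is not a finite union of proper subspaces. -/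
theorem exists_notMem_of_finite {k V : Type*} [Field k] [Infinite k] [AddCommGroup V] [Module k V]
    {s : Set (Submodule k V)} (hs : s.Finite) (h : ∀ W ∈ s, W ≠ ⊤) : ∃ x, ∀ W ∈ s, x ∉ W := by
  have h1 := Subspace.biUnion_ne_univ_of_top_notMem (s := hs.toFinset)
    fun ht => h ⊤ (hs.mem_toFinset.mp ht) rfl
  obtain ⟨x, hx⟩ := (Set.ne_univ_iff_exists_notMem _).mp h1
  refine ⟨x, fun W hW hxW => hx ?_⟩
  exact Set.mem_biUnion (hs.mem_toFinset.mpr hW) hxW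

/-- Generic combinations of elements of a Noetherian algebra over an infinite field cut down the
dimension as much as possible, away from their common zeros. -/
theorem exists_generic_combinations {k B V : Type*} [Field k] [Infinite k] [CommRing B]
    [IsNoetherianRing B] [Algebra k B] [AddCommGroup V] [Module k V] [FiniteDimensional k V]
    (f : V →ₗ[k] B) (j : ℕ) (hj : j ≤ Module.finrank k V) :
    ∃ c : Fin j → V, LinearIndependent k c ∧ ∀ Q : Ideal B, Q.IsPrime → (∀ i, f (c i) ∈ Q) →
      (∃ v, f v ∉ Q) → (j : ℕ∞) ≤ Q.height := by
  induction j with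
  | zero => exact ⟨Fin.elim0, linearIndependent_empty_type, fun Q _ _ _ => by simp⟩
  | succ j ih =>
    obtain ⟨c, hc, hQ⟩ := ih (Nat.le_of_succ_le hj)
    let I : Ideal B := Ideal.span (Set.range fun i => f (c i))
    let s : Set (Submodule k V) := insert (Submodule.span k (Set.range c))
      ((fun Q : Ideal B => (Q.restrictScalars k).comap f) '' {Q ∈ I.minimalPrimes | ∃ v, f v ∉ Q})
    have hs : s.Finite :=
      ((I.finite_minimalPrimes_of_isNoetherianRing.subset (Set.sep_subset _ _)).image _).insert _
    obtain ⟨x, hx⟩ := exists_notMem_of_finite hs (by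
      rintro W (rfl | ⟨Q, ⟨-, v, hv⟩, rfl⟩) hW
      · have h1 := finrank_span_eq_card hc
        rw [hW, finrank_top, Fintype.card_fin] at h1
        omega
      · have h1 : v ∈ (Q.restrictScalars k).comap f :=
          (show (Q.restrictScalars k).comap f = ⊤ from hW) ▸ Submodule.mem_top
        exact hv h1)
    refine ⟨Fin.cons x c, linearIndependent_finCons.mpr ⟨hc, hx _ (Set.mem_insert _ _)⟩, ?_⟩
    rintro Q hQp hcQ ⟨v, hv⟩
    have hIQ : I ≤ Q := by
      refine Ideal.span_le.mpr ?_
      rintro _ ⟨i, rfl⟩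
      simpa using hcQ i.succ
    obtain ⟨Q0, hQ0, hle⟩ := Ideal.exists_minimalPrimes_le hIQ
    have := hQ0.1.1
    have hvQ0 : f v ∉ Q0 := fun h => hv (hle h)
    have hxQ0 : f x ∉ Q0 := fun h =>
      hx _ (Set.mem_insert_of_mem _ ⟨Q0, ⟨hQ0, v, hvQ0⟩, rfl⟩) h
    have hlt : Q0 < Q := lt_of_le_of_ne hle fun h => hxQ0 (h ▸ by simpa using hcQ 0)
    have h1 := hQ Q0 this (fun i => hQ0.1.2 (Ideal.subset_span ⟨i, rfl⟩)) ⟨v, hvQ0⟩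
    push_cast
    exact (add_le_add_left h1 1).trans (Ideal.height_add_one_le_of_lt_of_isPrime hlt)

theorem exists_pow_le_of_forall_prime {R : Type*} [CommRing R] [IsLocalRing R]
    [IsNoetherianRing R] {J : Ideal R}
    (h : ∀ P : Ideal R, P.IsPrime → J ≤ P → P = maximalIdeal R) :
    ∃ n, maximalIdeal R ^ n ≤ J := by
  refine Ideal.exists_pow_le_of_le_radical_of_fg ?_ (IsNoetherian.noetherian _)
  rw [Ideal.radical_eq_sInf]
  exact le_sInf fun P hP => (h P hP.2 hP.1).ge

theorem eq_maximalIdeal_of_pow_le {R : Type*} [CommRing R] [IsLocalRing R] {P : Ideal R}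
    [hP : P.IsPrime] {n : ℕ} (h : maximalIdeal R ^ n ≤ P) : P = maximalIdeal R :=
  le_antisymm (le_maximalIdeal hP.ne_top) (hP.le_of_pow_le h)

/-- Krull's height theorem for an ideal of definition. -/
theorem ringKrullDim_le_of_pow_le {R : Type*} [CommRing R] [IsLocalRing R] [IsNoetherianRing R]
    {xs : List R} {n : ℕ} (h : maximalIdeal R ^ n ≤ Ideal.ofList xs)
    (hxs : Ideal.ofList xs ≤ maximalIdeal R) : ringKrullDim R ≤ xs.length := by
  classical
  rw [← maximalIdeal_height_eq_ringKrullDim]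
  have h1 : maximalIdeal R ∈ (Ideal.span (xs.toFinset : Set R)).minimalPrimes := by
    have e : Ideal.span (xs.toFinset : Set R) = Ideal.ofList xs := by
      rw [Ideal.ofList]
      congr 1
      ext x
      simp
    rw [e]
    refine ⟨⟨inferInstance, hxs⟩, fun P hP _ => ?_⟩
    have := hP.1
    exact (eq_maximalIdeal_of_pow_le (h.trans hP.2)).ge
  refine (WithBot.coe_le_coe.mpr (Ideal.height_le_card_of_mem_minimalPrimes_span_finset h1)).trans ?_
  exact_mod_cast List.toFinset_card_le xs

/-- General position of columns, over a local ring: if the dimension is at most `n + 1 - p`, then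
`n` generic combinations of `n + 1` columns still have maximal minors that are primary to the
maximal ideal. A prime `P` at which they fail yields a functional that kills the `n` combinations
over the residue field of `P`, hence a prime of `R[X₁, …, X_p]` that contains the corresponding
linear forms but is too small to do so. -/
theorem exists_generic_columns {k R : Type*} [Field k] [Infinite k] [CommRing R] [IsLocalRing R]
    [IsNoetherianRing R] [Algebra k R] {d p n : ℕ} (hdim : ringKrullDim R ≤ d) (hdp : d + p ≤ n + 1)
    (a : Fin (n + 1) → Fin p → R) {N : ℕ}
    (ha : maximalIdeal R ^ N ≤ minorIdeal (Submodule.span R (Set.range a))) :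
    ∃ c : Fin n → Fin (n + 1) → k, LinearIndependent k c ∧ ∃ N' : ℕ, maximalIdeal R ^ N' ≤
      minorIdeal (Submodule.span R (Set.range fun i => ∑ j, c i j • a j)) := by
  let B := MvPolynomial (Fin p) R
  let A : (Fin (n + 1) → k) →ₗ[k] (Fin p → R) := Fintype.linearCombination k a
  let form : (Fin p → R) →ₗ[k] B :=
    (Fintype.linearCombination R (fun i => (MvPolynomial.X i : B))).restrictScalars k
  obtain ⟨c, hc, hQ⟩ := exists_generic_combinations (form ∘ₗ A) n (by simp)
  refine ⟨c, hc, exists_pow_le_of_forall_prime fun P hP hle => ?_⟩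
  by_contra hne
  have hlt : P < maximalIdeal R := lt_of_le_of_ne (le_maximalIdeal hP.ne_top) hne
  let κ := FractionRing (R ⧸ P)
  let χ : R →+* κ := (algebraMap (R ⧸ P) κ).comp (Ideal.Quotient.mk P)
  have hχ : ∀ r, χ r = 0 ↔ r ∈ P := by
    intro r
    rw [RingHom.comp_apply, FaithfulSMul.algebraMap_eq_zero_iff, Ideal.Quotient.eq_zero_iff_mem]
  let W : Submodule κ (Fin p → κ) :=
    Submodule.span κ (Set.range fun i j => χ ((∑ l, c i l • a l) j))
  have hW : W < ⊤ := by
    rw [lt_top_iff_ne_top]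
    intro hW
    have h1 : minorIdeal W ≤ ⊥ := by
      rw [minorIdeal_span_range_map, Ideal.map_le_iff_le_comap]
      exact fun r hr => (hχ r).mpr (hle hr)
    have h2 : (Matrix.of fun i => (1 : Matrix (Fin p) (Fin p) κ) i).det ∈ minorIdeal W :=
      det_mem_minorIdeal fun i => hW ▸ Submodule.mem_top
    have h3 : (Matrix.of fun i => (1 : Matrix (Fin p) (Fin p) κ) i).det = 1 := Matrix.det_one
    rw [h3] at h2
    exact one_ne_zero (h1 h2)
  obtain ⟨l, hl0, hl⟩ := Submodule.exists_le_ker_of_lt_top W hW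
  let lam : Fin p → κ := fun i => l (Pi.single i 1)
  have hlam : ∀ y : Fin p → κ, l y = ∑ i, y i * lam i := by
    intro y
    conv_lhs => rw [pi_eq_sum_univ' y, map_sum]
    simp [lam]
  -- The functional `l`, whose coefficients are `lam`, is a point of affine `p`-space over `κ`; the
  -- kernel of `ev` is the prime of the line through this point and the origin.
  let ev : B →+* Polynomial κ :=
    MvPolynomial.eval₂Hom (Polynomial.C.comp χ) fun i => Polynomial.C (lam i) * Polynomial.X
  have evX : ∀ i, ev (MvPolynomial.X i) = Polynomial.C (lam i) * Polynomial.X :=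
    MvPolynomial.eval₂Hom_X' _ _
  have evC : ∀ r, ev (MvPolynomial.C r) = Polynomial.C (χ r) := MvPolynomial.eval₂Hom_C _ _
  have hev : ∀ y, ev (form y) = Polynomial.C (l fun i => χ (y i)) * Polynomial.X := by
    intro y
    simp only [form, LinearMap.restrictScalars_apply, Fintype.linearCombination_apply, map_sum,
      hlam, Finset.sum_mul]
    refine Finset.sum_congr rfl fun i _ => ?_
    rw [MvPolynomial.smul_eq_C_mul, map_mul, evX, evC, map_mul, mul_assoc]
  have hev0 : ∀ y, form y ∈ RingHom.ker ev ↔ l (fun i => χ (y i)) = 0 := by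
    intro y
    rw [RingHom.mem_ker, hev]
    simp
  have hprime : (RingHom.ker ev).IsPrime := RingHom.ker_isPrime ev
  have hA : ∀ x, A x = ∑ j, x j • a j := fun x => Fintype.linearCombination_apply k a x
  have h1 : (n : ℕ∞) ≤ (RingHom.ker ev).height := by
    refine hQ _ hprime (fun i => ?_) ?_
    · rw [LinearMap.comp_apply, hev0, hA]
      exact hl (Submodule.subset_span ⟨i, rfl⟩)
    · by_contra! hall
      obtain ⟨s, hs, hsP⟩ := SetLike.not_le_iff_exists.mp
        fun h => hne (eq_maximalIdeal_of_pow_le (P := P) (n := N) h)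
      let W' : Submodule κ (Fin p → κ) := Submodule.span κ (Set.range fun i j => χ (a i j))
      have h2 : χ s ∈ minorIdeal W' := by
        rw [minorIdeal_span_range_map]
        exact Ideal.mem_map_of_mem _ (ha hs)
      have h3 : W' ≤ LinearMap.ker l := by
        refine Submodule.span_le.mpr ?_
        rintro _ ⟨i, rfl⟩
        have := hall (Pi.single i 1)
        rw [LinearMap.comp_apply, hev0, hA] at this
        rwa [Finset.sum_eq_single i (fun j _ hj => by simp [hj]) (by simp), Pi.single_eq_same,
          one_smul] at this
      refine hl0 (LinearMap.ext fun y => ?_)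
      have h4 : l (χ s • y) = 0 := h3 (smul_mem_of_mem_minorIdeal h2 y)
      rw [map_smul, smul_eq_zero] at h4
      exact h4.resolve_left fun h => hsP ((hχ s).mp h)
  -- The chain `ker ev < Q1 < Q2` makes the height of `Q2` at least `n + 2`, which exceeds the
  -- dimension `dim R + p ≤ n + 1` of the polynomial ring.
  let Q1 : Ideal B := P.comap MvPolynomial.constantCoeff
  let Q2 : Ideal B := (maximalIdeal R).comap MvPolynomial.constantCoeff
  have hQ1 : Q1.IsPrime := Ideal.comap_isPrime _ _
  have hQ2 : Q2.IsPrime := Ideal.comap_isPrime _ _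
  have h01 : RingHom.ker ev < Q1 := by
    refine lt_of_le_of_ne (fun b hb => ?_) fun he => ?_
    · have h2 : (Polynomial.evalRingHom 0).comp ev = χ.comp MvPolynomial.constantCoeff := by
        ext i <;> simp [ev]
      have h3 := congrArg (fun g : B →+* κ => g b) h2
      simp only [RingHom.comp_apply, (RingHom.mem_ker).mp hb, map_zero] at h3
      exact (hχ _).mp h3.symm
    · refine hl0 (LinearMap.ext fun y => ?_)
      rw [hlam, LinearMap.zero_apply]
      refine Finset.sum_eq_zero fun i _ => ?_
      have h2 : (MvPolynomial.X i : B) ∈ RingHom.ker ev := by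
        rw [he, Ideal.mem_comap]
        simp
      rw [RingHom.mem_ker] at h2
      have h3 : lam i = 0 := by simpa [evX] using h2
      rw [h3, mul_zero]
  have h12 : Q1 < Q2 := by
    obtain ⟨s, hs, hsP⟩ := SetLike.exists_of_lt hlt
    refine lt_of_le_of_ne (Ideal.comap_mono hlt.le) fun he => hsP ?_
    have h2 : MvPolynomial.C s ∈ Q2 := by
      rw [Ideal.mem_comap, MvPolynomial.constantCoeff_C]
      exact hs
    rw [← he, Ideal.mem_comap, MvPolynomial.constantCoeff_C] at h2
    exact h2
  have h2 := Ideal.height_add_one_le_of_lt_of_isPrime h01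
  have h3 := Ideal.height_add_one_le_of_lt_of_isPrime h12
  have h4 : (Q2.height : WithBot ℕ∞) ≤ ((n + 1 : ℕ) : ℕ∞) := by
    refine (Ideal.height_le_ringKrullDim_of_ne_top hQ2.ne_top).trans ?_
    rw [MvPolynomial.ringKrullDim_of_isNoetherianRing]
    have : (d : WithBot ℕ∞) + p ≤ ((n + 1 : ℕ) : ℕ∞) := by exact_mod_cast hdp
    refine le_trans ?_ this
    rw [Nat.card_fin]
    exact add_le_add_left hdim _
  have h5 : (n : ℕ∞) + 1 + 1 ≤ ((n + 1 : ℕ) : ℕ∞) :=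
    ((add_le_add_left ((add_le_add_left h1 1).trans h2) 1).trans h3).trans
      (WithBot.coe_le_coe.mp h4)
  have h6 : n + 1 + 1 ≤ n + 1 := by exact_mod_cast h5
  omega

end GeneralPosition

/-! ### General position modulo an ideal -/

section RelativeGeneralPosition

/-- The inclusion `Rⁿ → Rⁿ⁺¹` whose image is `x₀ = 0`; composing with it deletes the first column
of a matrix. -/
def consZero {R : Type*} [CommRing R] (n : ℕ) : (Fin n → R) →ₗ[R] (Fin (n + 1) → R) where
  toFun b := Fin.cons 0 b
  map_add' x y := by
    ext i
    cases i using Fin.cases <;> simp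
  map_smul' r x := by
    ext i
    cases i using Fin.cases <;> simp

theorem range_eq_sup_span_singleton {R F : Type*} [CommRing R] [AddCommGroup F] [Module R F] {n : ℕ}
    (f : (Fin (n + 1) → R) →ₗ[R] F) : LinearMap.range f =
      LinearMap.range (f ∘ₗ consZero n) ⊔ Submodule.span R {f (Pi.single 0 1)} := by
  apply le_antisymm
  · rintro _ ⟨b, rfl⟩
    have h : b = consZero n (Fin.tail b) + b 0 • Pi.single 0 1 := by
      ext i
      cases i using Fin.cases <;> simp [consZero, Fin.tail]
    rw [h, map_add, map_smul]
    exact Submodule.add_mem_sup ⟨_, rfl⟩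
      (Submodule.smul_mem _ _ (Submodule.mem_span_singleton_self _))
  · refine sup_le (LinearMap.range_comp_le_range _ _) ?_
    exact (Submodule.span_singleton_le_iff_mem _ _).mpr ⟨_, rfl⟩

theorem range_eq_span_range {R F : Type*} [CommRing R] [AddCommGroup F] [Module R F] {n : ℕ}
    (f : (Fin n → R) →ₗ[R] F) :
    LinearMap.range f = Submodule.span R (Set.range fun i => f (Pi.single i 1)) := by
  rw [← Fintype.range_linearCombination]
  congr 1
  refine LinearMap.pi_ext' fun i => LinearMap.ext_ring ?_
  simp [Fintype.linearCombination_apply, Pi.single_apply]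

theorem map_maximalIdeal_quotient {R : Type*} [CommRing R] [IsLocalRing R] {I : Ideal R}
    [IsLocalRing (R ⧸ I)] :
    (maximalIdeal R).map (Ideal.Quotient.mk I) = maximalIdeal (R ⧸ I) := by
  have h1 : (maximalIdeal (R ⧸ I)).comap (Ideal.Quotient.mk I) = maximalIdeal R :=
    eq_maximalIdeal (Ideal.comap_isMaximal_of_surjective _ Ideal.Quotient.mk_surjective)
  rw [← h1, Ideal.map_comap_of_surjective _ Ideal.Quotient.mk_surjective]

variable (k : Type*) {R : Type*} [Field k] [Infinite k] [CommRing R] [IsLocalRing R]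
  [IsNoetherianRing R] [Algebra k R]

include k in
/-- General position of columns modulo an ideal `I`: after a change of basis `e` with constant
coefficients, the first column can be dropped, if `R / I` has dimension at most `n + 1 - p`. -/
theorem exists_generic_columns_mod {I : Ideal R} (hI : I ≤ maximalIdeal R) {xs : List R}
    (hxs : ∀ x ∈ xs, x ∈ maximalIdeal R) {N : ℕ}
    (hN : maximalIdeal R ^ N ≤ I ⊔ Ideal.ofList xs) {n p : ℕ} (hn : xs.length + p ≤ n + 1)
    (f : (Fin (n + 1) → R) →ₗ[R] (Fin p → R))
    (hf : Cofinite (LinearMap.range f ⊔ coordIdeal _ I)) :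
    ∃ e : (Fin (n + 1) → R) →ₗ[R] (Fin (n + 1) → R), Function.Surjective e ∧ ∃ N' : ℕ,
      maximalIdeal R ^ N' ≤ minorIdeal (LinearMap.range ((f ∘ₗ e) ∘ₗ consZero n)) ⊔ I := by
  have hne : I ≠ ⊤ := fun h => (maximalIdeal.isMaximal R).ne_top (top_le_iff.mp (h ▸ hI))
  have := Ideal.Quotient.nontrivial_iff.mpr hne
  have : IsLocalRing (R ⧸ I) :=
    IsLocalRing.of_surjective' (Ideal.Quotient.mk I) Ideal.Quotient.mk_surjective
  have hm := map_maximalIdeal_quotient (I := I)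
  have hdim : ringKrullDim (R ⧸ I) ≤ xs.length := by
    have h1 : (Ideal.ofList xs).map (Ideal.Quotient.mk I) =
        Ideal.ofList (xs.map (Ideal.Quotient.mk I)) := Ideal.map_ofList _ _
    have h2 := ringKrullDim_le_of_pow_le (R := R ⧸ I) (xs := xs.map (Ideal.Quotient.mk I)) (n := N)
    rw [List.length_map] at h2
    apply h2
    · rw [← h1, ← hm, ← Ideal.map_pow]
      refine (Ideal.map_mono hN).trans ?_
      rw [Ideal.map_sup, Ideal.map_quotient_self, bot_sup_eq]
    · rw [← h1, ← hm]
      exact Ideal.map_mono (Ideal.span_le.mpr hxs)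
  obtain ⟨N1, hN1⟩ := hf.exists_pow_le_minorIdeal
  let a : Fin (n + 1) → Fin p → R := fun i => f (Pi.single i 1)
  have ha : maximalIdeal (R ⧸ I) ^ N1 ≤ minorIdeal (Submodule.span (R ⧸ I)
      (Set.range fun i j => Ideal.Quotient.mk I (a i j))) := by
    rw [minorIdeal_span_range_map, ← hm, ← Ideal.map_pow, ← range_eq_span_range]
    refine (Ideal.map_mono hN1).trans ?_
    rw [Ideal.map_sup, Ideal.map_quotient_self, sup_bot_eq]
  obtain ⟨c, hc, N', hN'⟩ := exists_generic_columns (k := k) hdim hn _ ha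
  -- The vectors `c` are completed to a basis.
  obtain ⟨x, hx⟩ : ∃ x, x ∉ Submodule.span k (Set.range c) := by
    by_contra! h
    have h1 := finrank_span_eq_card hc
    rw [(Submodule.eq_top_iff'.mpr h), finrank_top] at h1
    simp at h1
  have hc' : LinearIndependent k (Fin.cons x c : Fin (n + 1) → Fin (n + 1) → k) :=
    linearIndependent_finCons.mpr ⟨hc, hx⟩
  let toR : (Fin (n + 1) → k) →ₗ[k] (Fin (n + 1) → R) :=
    (Algebra.linearMap k R).compLeft (Fin (n + 1))
  let e : (Fin (n + 1) → R) →ₗ[R] (Fin (n + 1) → R) :=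
    Fintype.linearCombination R fun i => toR ((Fin.cons x c : Fin (n + 1) → Fin (n + 1) → k) i)
  refine ⟨e, ?_, N', ?_⟩
  · have h1 : ((LinearMap.range e).restrictScalars k).comap toR = ⊤ := by
      rw [← top_le_iff, ← hc'.span_eq_top_of_card_eq_finrank (by simp), Submodule.span_le]
      rintro _ ⟨i, rfl⟩
      exact ⟨Pi.single i 1, by simp [e]⟩
    rw [← LinearMap.range_eq_top, ← top_le_iff]
    intro b _
    rw [pi_eq_sum_univ' b]
    refine Submodule.sum_mem _ fun i _ => Submodule.smul_mem _ _ ?_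
    have h2 : (Pi.single i 1 : Fin (n + 1) → k) ∈
        ((LinearMap.range e).restrictScalars k).comap toR := h1 ▸ Submodule.mem_top
    have h3 : toR (Pi.single i 1) = Pi.single i 1 := by
      ext j
      by_cases hij : j = i
      · subst hij; simp [toR]
      · simp [toR, hij]
    rw [Submodule.mem_comap, h3] at h2
    exact h2
  · have h1 : ∀ i : Fin n, ((f ∘ₗ e) ∘ₗ consZero n) (Pi.single i 1) = ∑ j, c i j • a j := by
      intro i
      have h2 : consZero (R := R) n (Pi.single i 1) = Pi.single i.succ 1 := by
        ext j
        cases j using Fin.cases with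
        | zero => simp [consZero]
        | succ j => simp [consZero, Pi.single_apply]
      rw [LinearMap.comp_apply, h2, LinearMap.comp_apply]
      simp only [e, Fintype.linearCombination_apply_single, one_smul, Fin.cons_succ]
      rw [pi_eq_sum_univ' (toR (c i)), map_sum]
      refine Finset.sum_congr rfl fun j _ => ?_
      rw [map_smul]
      exact algebraMap_smul R (c i j) (a j)
    have h2 : (fun i j => Ideal.Quotient.mk I ((∑ l, c i l • a l) j)) =
        fun i => ∑ l, c i l • fun j => Ideal.Quotient.mk I (a l j) := by
      ext i j
      simp only [Finset.sum_apply, map_sum, Pi.smul_apply]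
      rfl
    rw [← h2, minorIdeal_span_range_map (Ideal.Quotient.mk I), ← hm, ← Ideal.map_pow,
      Ideal.map_le_iff_le_comap, Ideal.comap_map_of_surjective _ Ideal.Quotient.mk_surjective,
      ← RingHom.ker_eq_comap_bot, Ideal.mk_ker] at hN'
    rw [range_eq_span_range]
    simp only [h1]
    exact hN'

include k in
/-- A column `v` may be replaced by a vector `w` with first coordinate `1`. The minors of the
remaining columns define a scheme of dimension at most one, so only finitely many primes have to be
avoided by `w`, which is taken to be a combination of `v` and the first basis vector, up to a
unit. -/
theorem exists_unit_column {q : ℕ} {M : Submodule R (Fin (q + 1) → R)} {I : Ideal R} {u : R}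
    (hum : u ∈ maximalIdeal R) {n : ℕ} (hn : maximalIdeal R ^ n ≤ minorIdeal M ⊔ I ⊔ Ideal.span {u})
    {v : Fin (q + 1) → R} (hv : Cofinite (M ⊔ Submodule.span R {v} ⊔ coordIdeal _ I)) :
    ∃ w : Fin (q + 1) → R, w 0 = 1 ∧ Cofinite (M ⊔ Submodule.span R {w} ⊔ coordIdeal _ I) := by
  let g : (Fin 2 → k) →ₗ[k] (Fin (q + 1) → R) :=
    Fintype.linearCombination k ![Pi.single 0 1, v]
  have hg1 : g (Pi.single 0 1) = Pi.single 0 1 := by simp [g]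
  have hg2 : g (Pi.single 1 1) = v := by simp [g]
  let S : Ideal R → Submodule k (Fin 2 → k) := fun P =>
    ⨅ φ ∈ minorFunctionals M, (P.restrictScalars k).comap ((φ.restrictScalars k) ∘ₗ g)
  have hS : ∀ P c, c ∈ S P ↔ ∀ φ ∈ minorFunctionals M, φ (g c) ∈ P := by
    intro P c
    simp [S, Submodule.mem_iInf]
  let S0 : Submodule k (Fin 2 → k) :=
    ((maximalIdeal R).restrictScalars k).comap (((LinearMap.proj 0 :
      (Fin (q + 1) → R) →ₗ[R] R).restrictScalars k) ∘ₗ g)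
  let T : Set (Submodule k (Fin 2 → k)) :=
    insert S0 (S '' {P ∈ (minorIdeal M ⊔ I).minimalPrimes | P ≠ maximalIdeal R})
  have hT : T.Finite := (((minorIdeal M ⊔ I).finite_minimalPrimes_of_isNoetherianRing.subset
    (Set.sep_subset _ _)).image _).insert _
  obtain ⟨l, hl⟩ := hv.exists_pow_le_minorIdeal
  obtain ⟨c, hc⟩ := exists_notMem_of_finite hT (by
    rintro W (rfl | ⟨P, ⟨hP, hPm⟩, rfl⟩) hW
    · have h1 : (Pi.single 0 1 : Fin 2 → k) ∈ S0 := hW ▸ Submodule.mem_top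
      have h2 : g (Pi.single 0 1) 0 ∈ maximalIdeal R := h1
      rw [hg1, Pi.single_eq_same] at h2
      exact (Ideal.ne_top_iff_one _).mp (maximalIdeal.isMaximal R).ne_top h2
    · have h1 : (Pi.single 1 1 : Fin 2 → k) ∈ S P := hW ▸ Submodule.mem_top
      rw [hS, hg2] at h1
      have := hP.1.1
      refine hPm (eq_maximalIdeal_of_pow_le (hl.trans ?_))
      rw [minorIdeal_sup_span_singleton, sup_right_comm]
      refine sup_le hP.1.2 ?_
      rintro _ ⟨φ, hφ, rfl⟩
      exact h1 φ hφ)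
  have hunit : IsUnit (g c 0) := by
    by_contra h
    exact hc S0 (Set.mem_insert _ _) ((mem_maximalIdeal _).mpr h)
  obtain ⟨r, hr⟩ := hunit
  refine ⟨(↑r⁻¹ : R) • g c, by rw [Pi.smul_apply, ← hr, smul_eq_mul, Units.inv_mul], ?_⟩
  have hspan : Submodule.span R {(↑r⁻¹ : R) • g c} = Submodule.span R {g c} :=
    Submodule.span_singleton_smul_eq r⁻¹.isUnit _
  rw [hspan]
  obtain ⟨N, hN⟩ := exists_pow_le_of_forall_prime
    (J := minorIdeal (M ⊔ Submodule.span R {g c}) ⊔ I) fun P hP hle => by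
      by_contra hPm
      rw [minorIdeal_sup_span_singleton, sup_right_comm, sup_le_iff] at hle
      obtain ⟨Q, hQ, hQP⟩ := Ideal.exists_minimalPrimes_le hle.1
      have hQp := hQ.1.1
      -- A chain `Q < P < 𝔪` is impossible, since `𝔪` is minimal over `(Q, u)`.
      have hQeq : Q = P := by
        by_contra hQne
        have hmin : maximalIdeal R ∈ (Q ⊔ Ideal.span {u}).minimalPrimes := by
          refine ⟨⟨inferInstance, sup_le (le_maximalIdeal hQp.ne_top)
            ((Ideal.span_singleton_le_iff_mem _).mpr hum)⟩, fun P' hP' _ => ?_⟩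
          have := hP'.1
          exact (eq_maximalIdeal_of_pow_le
            (hn.trans ((sup_le_sup_right hQ.1.2 _).trans hP'.2))).ge
        have h1 := Ideal.map_height_le_one_of_mem_minimalPrimes hmin
        have hker : ∀ {A : Ideal R}, Q ≤ A →
            (A.map (Ideal.Quotient.mk Q)).comap (Ideal.Quotient.mk Q) = A := by
          intro A hA
          rw [Ideal.comap_map_of_surjective _ Ideal.Quotient.mk_surjective,
            ← RingHom.ker_eq_comap_bot, Ideal.mk_ker, sup_eq_left.mpr hA]
        have hPp : (P.map (Ideal.Quotient.mk Q)).IsPrime :=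
          Ideal.isPrime_map_quotientMk_of_isPrime hQP
        have hmp : ((maximalIdeal R).map (Ideal.Quotient.mk Q)).IsPrime :=
          Ideal.isPrime_map_quotientMk_of_isPrime (le_maximalIdeal hQp.ne_top)
        have hbot : (⊥ : Ideal (R ⧸ Q)).IsPrime := Ideal.isPrime_bot
        have h2 : (⊥ : Ideal (R ⧸ Q)) < P.map (Ideal.Quotient.mk Q) := by
          refine bot_lt_iff_ne_bot.mpr fun h => hQne (le_antisymm hQP ?_)
          rwa [Ideal.map_eq_bot_iff_le_ker, Ideal.mk_ker] at h
        have h3 : P.map (Ideal.Quotient.mk Q) < (maximalIdeal R).map (Ideal.Quotient.mk Q) := by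
          refine lt_of_le_of_ne (Ideal.map_mono (le_maximalIdeal hP.ne_top)) fun h => hPm ?_
          rw [← hker hQP, h, hker (le_maximalIdeal hQp.ne_top)]
        have h4 := Ideal.height_add_one_le_of_lt_of_isPrime h2
        have h5 := Ideal.height_add_one_le_of_lt_of_isPrime h3
        have h6 : (0 : ℕ∞) + 1 + 1 ≤ 1 :=
          (add_le_add_left (add_le_add_left zero_le _) _).trans
            ((add_le_add_left h4 1).trans (h5.trans h1))
        exact absurd h6 (by decide)
      refine hc (S Q) (Set.mem_insert_of_mem _ ⟨Q, ⟨hQ, hQeq ▸ hPm⟩, rfl⟩) ((hS _ _).mpr ?_)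
      exact fun φ hφ => hQeq ▸ hle.2 ⟨φ, hφ, rfl⟩
  exact cofinite_of_pow_le_minorIdeal hN

end RelativeGeneralPosition

/-! ### Induction on the dimension -/

section Induction

/-- The elements `xs` are a system of parameters of `R / I` and a regular sequence, so that `R / I` is
Cohen–Macaulay. The dimension of `R / I` is then the length of `xs`, and is not mentioned. -/
structure IsRegularSop {R : Type*} [CommRing R] [IsLocalRing R] (I : Ideal R) (xs : List R) :
    Prop where
  le_maximalIdeal : I ≤ maximalIdeal R
  mem_maximalIdeal : ∀ x ∈ xs, x ∈ maximalIdeal R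
  regSeq : RegSeq I xs
  exists_pow_le : ∃ N : ℕ, maximalIdeal R ^ N ≤ I ⊔ Ideal.ofList xs

theorem pow_le_sup_span_pow {R : Type*} [CommRing R] {a J : Ideal R} {u : R} {N : ℕ}
    (h : a ^ N ≤ J ⊔ Ideal.span {u}) (k : ℕ) : a ^ (N * k) ≤ J ⊔ Ideal.span {u ^ k} := by
  rw [pow_mul]
  exact (Ideal.pow_right_mono h k).trans (sup_span_singleton_pow_le _ _ _)

theorem IsRegularSop.sup_pow {R : Type*} [CommRing R] [IsLocalRing R] {I : Ideal R} {u : R}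
    {ys : List R} (h : IsRegularSop I (u :: ys)) (k : ℕ) :
    IsRegularSop (I ⊔ Ideal.span {u ^ (k + 1)}) ys where
  le_maximalIdeal := sup_le h.le_maximalIdeal ((Ideal.span_singleton_le_iff_mem _).mpr
    (Ideal.pow_mem_of_mem _ (h.mem_maximalIdeal u (by simp)) _ k.succ_pos))
  mem_maximalIdeal x hx := h.mem_maximalIdeal x (List.mem_cons_of_mem _ hx)
  regSeq := RegSeq.sup_pow h.regSeq.1 h.regSeq.2 _
  exists_pow_le := by
    obtain ⟨N, hN⟩ := h.exists_pow_le
    rw [Ideal.ofList_cons, sup_comm (Ideal.span _), ← sup_assoc] at hN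
    refine ⟨N * (k + 1), ?_⟩
    rw [sup_right_comm]
    exact pow_le_sup_span_pow hN _

/-- The equality of colengths for all matrices modulo `I` of the size that is expected when
`R / I` has dimension `d`. -/
def ColengthFormula {R : Type*} [CommRing R] [IsLocalRing R] (I : Ideal R) (d : ℕ) : Prop :=
  ∀ (p n : ℕ) (f : (Fin n → R) →ₗ[R] (Fin p → R)), n + 1 = d + p →
    Cofinite (LinearMap.range f ⊔ coordIdeal _ I) →
    Module.length R ((Fin p → R) ⧸ (LinearMap.range f ⊔ coordIdeal _ I)) =
      Module.length R (R ⧸ (minorIdeal (LinearMap.range f) ⊔ I))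

/-- For all matrices modulo `I` of the size that is expected when `R / I` has dimension `d`, the
syzygies are generated by the ones from Cramer's rule: this is exactness of the Buchsbaum–Rim
complex at the source of `f`. -/
def SyzygiesCramer {R : Type*} [CommRing R] [IsLocalRing R] (I : Ideal R) (d : ℕ) : Prop :=
  ∀ (p n : ℕ) (f : (Fin n → R) →ₗ[R] (Fin p → R)), n + 1 = d + p →
    Cofinite (LinearMap.range f ⊔ coordIdeal _ I) →
    ∀ b, f b ∈ coordIdeal _ I → b ∈ cramerSyzygies f ⊔ coordIdeal _ I

variable (k : Type*) {R : Type*} [Field k] [Infinite k] [CommRing R] [IsLocalRing R]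
  [IsNoetherianRing R] [Algebra k R]

include k in
/-- After a change of basis of the source, the columns other than the first have an ideal of minors
that is Cohen–Macaulay of dimension one: the parameter `u` is regular modulo these minors. -/
theorem exists_regular_columns {I : Ideal R} {u : R} {ys : List R}
    (h : IsRegularSop I (u :: ys))
    (hT : ys ≠ [] → ∀ j, ColengthFormula (I ⊔ Ideal.span {u ^ (j + 1)}) ys.length)
    (hS : ys ≠ [] → SyzygiesCramer (I ⊔ Ideal.span {u}) ys.length) {q n : ℕ}
    (hn : n = ys.length + q) (f : (Fin (n + 1) → R) →ₗ[R] (Fin (q + 1) → R))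
    (hf : Cofinite (LinearMap.range f ⊔ coordIdeal _ I)) :
    ∃ e : (Fin (n + 1) → R) →ₗ[R] (Fin (n + 1) → R), Function.Surjective e ∧
      (∀ y, u * y ∈ minorIdeal (LinearMap.range ((f ∘ₗ e) ∘ₗ consZero n)) ⊔ I →
        y ∈ minorIdeal (LinearMap.range ((f ∘ₗ e) ∘ₗ consZero n)) ⊔ I) ∧
      ∃ N : ℕ, maximalIdeal R ^ N ≤
        minorIdeal (LinearMap.range ((f ∘ₗ e) ∘ₗ consZero n)) ⊔ I ⊔ Ideal.span {u} := by
  have hum := h.mem_maximalIdeal u (by simp)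
  by_cases hys : ys = []
  · subst hys
    obtain rfl : n = q := by simpa using hn
    refine ⟨LinearMap.id, Function.surjective_id, ?_⟩
    rw [minorIdeal_range_of_fin, bot_sup_eq]
    refine ⟨h.regSeq.1, ?_⟩
    obtain ⟨N, hN⟩ := h.exists_pow_le
    exact ⟨N, by simpa using hN⟩
  · have h1 := h.sup_pow 0
    rw [zero_add, pow_one] at h1
    obtain ⟨N, hN⟩ := h1.exists_pow_le
    obtain ⟨e, he, N', hN'⟩ := exists_generic_columns_mod k h1.le_maximalIdeal h1.mem_maximalIdeal
      hN (p := q + 1) (n := n) (by omega) f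
      (hf.mono (sup_le_sup_left (coordIdeal_mono le_sup_left) _))
    refine ⟨e, he, ?_⟩
    set g := (f ∘ₗ e) ∘ₗ consZero n
    rw [← sup_assoc] at hN'
    refine ⟨?_, N', hN'⟩
    have hsize : n + 1 = ys.length + (q + 1) := by omega
    have hpow : ∀ j, maximalIdeal R ^ (N' * j) ≤
        minorIdeal (LinearMap.range g) ⊔ (I ⊔ Ideal.span {u ^ j}) := fun j => by
      rw [← sup_assoc]
      exact pow_le_sup_span_pow hN' j
    have hreg := regular_coker_of_syzygies g h.regSeq.1
      (hS hys _ _ g hsize (cofinite_of_pow_le_minorIdeal (n := N') (by rwa [← sup_assoc])))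
    have hform : ∀ j, Module.length R ((Fin (q + 1) → R) ⧸
        (LinearMap.range g ⊔ coordIdeal _ (I ⊔ Ideal.span {u ^ (j + 1)}))) =
        Module.length R (R ⧸ (minorIdeal (LinearMap.range g) ⊔ I ⊔ Ideal.span {u ^ (j + 1)})) :=
      fun j => by
        rw [sup_assoc]
        exact hT hys j _ _ g hsize (cofinite_of_pow_le_minorIdeal (hpow _))
    refine regular_of_length_pow hum (fun j => ?_) fun j => ?_
    · rw [sup_assoc]
      exact length_quotient_ne_top (hpow j)
    · cases j with
      | zero =>
        have : Subsingleton (R ⧸ (minorIdeal (LinearMap.range g) ⊔ I ⊔ Ideal.span {u ^ 0})) :=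
          Ideal.Quotient.subsingleton_iff.mpr (by simp)
        rw [Module.length_eq_zero (M := R ⧸ (_ ⊔ Ideal.span {u ^ 0})), zero_add, zero_add, pow_one]
      | succ j =>
        have h2 := hform 0
        rw [zero_add, pow_one] at h2
        rw [← hform, ← hform, ← h2]
        exact length_quotient_pow_succ hreg (j + 1)

include k in
/-- Induction on the number of rows. One column is exchanged for a column with first coordinate `1`,
and then this column and the first row are removed. -/
theorem colengthFormula_of_regular_columns {I : Ideal R} {u : R} {ys : List R}
    (h : IsRegularSop I (u :: ys))
    (hT : ys ≠ [] → ∀ j, ColengthFormula (I ⊔ Ideal.span {u ^ (j + 1)}) ys.length)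
    (hS : ys ≠ [] → SyzygiesCramer (I ⊔ Ideal.span {u}) ys.length) :
    ColengthFormula I (ys.length + 1) := by
  have hum := h.mem_maximalIdeal u (by simp)
  intro p
  induction p with
  | zero =>
    intro n f _ _
    have h1 : minorIdeal (LinearMap.range f) ⊔ I = ⊤ := by
      rw [Ideal.eq_top_iff_one]
      refine Submodule.mem_sup_left ?_
      have := det_mem_minorIdeal (M := LinearMap.range f) (w := Fin.elim0) fun i => i.elim0
      rwa [Matrix.det_fin_zero] at this
    have := Ideal.Quotient.subsingleton_iff.mpr h1
    have : Subsingleton ((Fin 0 → R) ⧸ (LinearMap.range f ⊔ coordIdeal _ I)) :=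
      Quot.Subsingleton
    simp
  | succ q ih =>
    intro n f hn hf
    obtain _ | n := n
    · omega
    obtain ⟨e, he, hu, N, hN⟩ := exists_regular_columns k h hT hS (by omega) f hf
    have hrange : LinearMap.range f = LinearMap.range ((f ∘ₗ e) ∘ₗ consZero n) ⊔
        Submodule.span R {(f ∘ₗ e) (Pi.single 0 1)} := by
      rw [← range_eq_sup_span_singleton, LinearMap.range_comp, LinearMap.range_eq_top.mpr he,
        Submodule.map_top]
    rw [hrange] at hf ⊢
    generalize (f ∘ₗ e) (Pi.single 0 1) = v at *
    generalize (f ∘ₗ e) ∘ₗ consZero n = g at *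
    obtain ⟨w, hw0, hw⟩ := exists_unit_column k hum hN hf
    have hex := length_exchange hum hu hN hf hw
    -- Since `w` is a basis vector, it can be split off.
    have hwM : w ∈ LinearMap.range g ⊔ Submodule.span R {w} :=
      Submodule.mem_sup_right (Submodule.mem_span_singleton_self w)
    have hmap : (LinearMap.range g ⊔ Submodule.span R {w}).map (projAlong w) =
        LinearMap.range (projAlong w ∘ₗ g) := by
      rw [Submodule.map_sup, ← LinearMap.range_comp, Submodule.map_span, Set.image_singleton,
        sup_eq_left, Submodule.span_singleton_le_iff_mem]
      have : projAlong w w = 0 := by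
        ext j
        simp [projAlong_apply, hw0]
      rw [this]
      exact zero_mem _
    have hcoord : (coordIdeal (Fin (q + 1)) I).map (projAlong w) = coordIdeal (Fin q) I := by
      refine le_antisymm (Submodule.map_le_iff_le_comap.mpr fun y hy =>
        apply_mem_coordIdeal (projAlong w) hy) fun y hy => ⟨Fin.cons 0 y, ?_, ?_⟩
      · refine mem_coordIdeal.mpr fun i => ?_
        cases i using Fin.cases with
        | zero => simp
        | succ i => simpa using mem_coordIdeal.mp hy i
      · ext j
        simp [projAlong_apply]
    have hw' := hw.exists_pow_le_minorIdeal
    rw [← minorIdeal_map_projAlong hw0 hwM, hmap] at hw'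
    have hred := ih n (projAlong w ∘ₗ g) (by omega)
      (cofinite_of_pow_le_minorIdeal hw'.choose_spec)
    rw [← hmap, minorIdeal_map_projAlong hw0 hwM, ← hcoord, ← Submodule.map_sup,
      ← length_quotient_map_projAlong hw0 (Submodule.mem_sup_left hwM)] at hred
    rw [hred, add_comm] at hex
    obtain ⟨N', hN'⟩ := hw.exists_pow_le_minorIdeal
    exact WithTop.add_left_cancel (length_quotient_ne_top hN') hex

include k in
/-- The syzygies lift from `(I, u)` to `I` for the matrix without its first column, and from there to
the whole matrix. For `d = 1` the matrix is square, and there are no syzygies. -/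
theorem syzygiesCramer_of_regular_columns {I : Ideal R} {u : R} {ys : List R}
    (h : IsRegularSop I (u :: ys))
    (hT : ys ≠ [] → ∀ j, ColengthFormula (I ⊔ Ideal.span {u ^ (j + 1)}) ys.length)
    (hS : ys ≠ [] → SyzygiesCramer (I ⊔ Ideal.span {u}) ys.length) :
    SyzygiesCramer I (ys.length + 1) := by
  have hum := h.mem_maximalIdeal u (by simp)
  intro p n f hn hf b hb
  obtain _ | q := p
  · refine Submodule.mem_sup_left (Submodule.subset_span ⟨Fin.elim0, b, ?_⟩)
    simp [cramerSyzygy]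
  by_cases hys : ys = []
  · subst hys
    obtain rfl : n = q + 1 := by
      rw [List.length_nil] at hn
      omega
    obtain ⟨N, hN⟩ := hf.exists_pow_le_minorIdeal
    refine Submodule.mem_sup_right (mem_coordIdeal.mpr fun i => regular_mod_pow h.regSeq.1 N _ ?_)
    exact mul_apply_mem_of_mem_minorIdeal f hb (hN (Ideal.pow_mem_pow hum N)) i
  obtain _ | n := n
  · omega
  obtain ⟨e, he, hu, N, hN⟩ := exists_regular_columns k h hT hS (by omega) f hf
  have hrange : LinearMap.range f = LinearMap.range ((f ∘ₗ e) ∘ₗ consZero n) ⊔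
      Submodule.span R {(f ∘ₗ e) (Pi.single 0 1)} := by
    rw [← range_eq_sup_span_singleton, LinearMap.range_comp, LinearMap.range_eq_top.mpr he,
      Submodule.map_top]
  rw [hrange] at hf
  obtain ⟨b, rfl⟩ := he b
  have h1 := mem_cramerSyzygies_of_tail hum (f ∘ₗ e) (consZero n) (fun _ => rfl) hf hu
    (mem_cramerSyzygies_of_regular hum _ h.regSeq.1
      (hS hys _ _ _ (by omega) (cofinite_of_pow_le_minorIdeal (n := N) (by rwa [← sup_assoc])))) b hb
  obtain ⟨s, hs, t, ht, rfl⟩ := Submodule.mem_sup.mp h1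
  rw [map_add]
  exact Submodule.add_mem_sup (map_cramerSyzygies_le f e ⟨s, hs, rfl⟩) (apply_mem_coordIdeal e ht)

include k in
theorem colengthFormula_and_syzygiesCramer (ys : List R) : ∀ {I : Ideal R} {u : R},
    IsRegularSop I (u :: ys) →
      ColengthFormula I (ys.length + 1) ∧ SyzygiesCramer I (ys.length + 1) := by
  induction ys with
  | nil =>
    exact fun h => ⟨colengthFormula_of_regular_columns k h (by simp) (by simp),
      syzygiesCramer_of_regular_columns k h (by simp) (by simp)⟩
  | cons y ys ih =>
    intro I u h
    have hT := fun j => (ih (h.sup_pow j)).1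
    have hS := (ih (h.sup_pow 0)).2
    rw [zero_add, pow_one] at hS
    exact ⟨colengthFormula_of_regular_columns k h (fun _ => hT) fun _ => hS,
      syzygiesCramer_of_regular_columns k h (fun _ => hT) fun _ => hS⟩

end Induction

/-! ### Passage to the completion -/

section Transfer

/-- The properties of the completion `S` of a local ring `R` with finitely generated maximal ideal
that are needed here: the maximal ideal of `S` is the extension of that of `R`, and
`R / 𝔪ᵏ → S / 𝔪ᵏS` is bijective for all `k`. -/
structure IsCompletionMap (R S : Type*) [CommRing R] [IsLocalRing R] [CommRing S] [IsLocalRing S]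
    [Algebra R S] : Prop where
  map_maximalIdeal : (maximalIdeal R).map (algebraMap R S) = maximalIdeal S
  exists_sub_mem : ∀ (k : ℕ) (s : S), ∃ r, s - algebraMap R S r ∈ maximalIdeal S ^ k
  mem_pow : ∀ (k : ℕ) (r : R), algebraMap R S r ∈ maximalIdeal S ^ k → r ∈ maximalIdeal R ^ k

/-- If every element of `S` acts as some element of `R`, then `R`- and `S`-submodules agree. -/
theorem length_eq_of_forall_exists_smul {R S Q : Type*} [CommRing R] [CommRing S] [Algebra R S]
    [AddCommGroup Q] [Module R Q] [Module S Q] [IsScalarTower R S Q]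
    (h : ∀ s : S, ∃ r : R, ∀ q : Q, s • q = r • q) : Module.length R Q = Module.length S Q := by
  let e : Submodule S Q ≃o Submodule R Q :=
    { toFun := Submodule.restrictScalars R
      invFun := fun N =>
        { N.toAddSubmonoid with
          smul_mem' := fun s q hq => by
            obtain ⟨r, hr⟩ := h s
            rw [hr]
            exact N.smul_mem r hq }
      left_inv := fun _ => rfl
      right_inv := fun _ => rfl
      map_rel_iff' := Iff.rfl }
  rw [Module.length, Module.length, WithBot.unbot_inj, Order.krullDim_eq_of_orderIso e]

section

variable {R S P Q : Type*} [CommRing R] [CommRing S] [Algebra R S] [AddCommGroup P] [Module R P]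
  [AddCommGroup Q] [Module R Q] [Module S Q] [IsScalarTower R S Q]

omit [Algebra R S] [IsScalarTower R S Q] in
/-- A submodule `N` is the contraction of its extension, if elements of `S` can be replaced by
elements of `R` up to an error in a submodule `T` whose preimage is contained in `N`. -/
theorem mem_of_apply_mem_span (h : P →ₗ[R] Q) {N : Submodule R P} {T : Submodule S Q}
    (hT : ∀ y, h y ∈ T → y ∈ N) (hs : ∀ s : S, ∃ r : R, ∀ q : Q, s • q - r • q ∈ T) {y : P}
    (hy : h y ∈ Submodule.span S (h '' N)) : y ∈ N := by
  have key : ∀ q ∈ Submodule.span S (h '' N), ∃ n ∈ N, q - h n ∈ T := by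
    intro q hq
    induction hq using Submodule.span_induction with
    | mem q hq =>
      obtain ⟨n, hn, rfl⟩ := hq
      exact ⟨n, hn, by simp⟩
    | zero => exact ⟨0, N.zero_mem, by simp⟩
    | add x y _ _ hx hy =>
      obtain ⟨a, ha, ha'⟩ := hx
      obtain ⟨b, hb, hb'⟩ := hy
      refine ⟨a + b, N.add_mem ha hb, ?_⟩
      rw [map_add, add_sub_add_comm]
      exact T.add_mem ha' hb'
    | smul s x _ hx =>
      obtain ⟨a, ha, ha'⟩ := hx
      obtain ⟨r, hr⟩ := hs s
      refine ⟨r • a, N.smul_mem r ha, ?_⟩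
      rw [map_smul, ← sub_add_sub_cancel (s • x) (s • h a), ← smul_sub]
      exact T.add_mem (T.smul_mem s ha') (hr _)
  obtain ⟨n, hn, hn'⟩ := key _ hy
  rw [← map_sub] at hn'
  rw [← sub_add_cancel y n]
  exact N.add_mem (hT _ hn') hn

/-- A submodule and its extension have the same colength, if scalars and vectors can be replaced by
ones from `R` and `P` up to an error in `T`. -/
theorem length_quotient_span_image (h : P →ₗ[R] Q) {N : Submodule R P} {T : Submodule S Q}
    (hT : ∀ y, h y ∈ T → y ∈ N) (hTN : T ≤ Submodule.span S (h '' N))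
    (hs : ∀ s : S, ∃ r : R, ∀ q : Q, s • q - r • q ∈ T) (hd : ∀ q, ∃ y, q - h y ∈ T) :
    Module.length R (P ⧸ N) = Module.length S (Q ⧸ Submodule.span S (h '' N)) := by
  let N' := Submodule.span S (h '' N)
  let g : P →ₗ[R] Q ⧸ N' := (N'.mkQ.restrictScalars R) ∘ₗ h
  have hg : Function.Surjective g := by
    intro x
    obtain ⟨q, rfl⟩ := N'.mkQ_surjective x
    obtain ⟨y, hy⟩ := hd q
    refine ⟨y, ?_⟩
    change N'.mkQ (h y) = N'.mkQ q
    rw [eq_comm, ← sub_eq_zero, ← map_sub, Submodule.mkQ_apply, Submodule.Quotient.mk_eq_zero]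
    exact hTN hy
  have hker : LinearMap.ker g = N := by
    ext y
    change N'.mkQ (h y) = 0 ↔ _
    rw [Submodule.mkQ_apply, Submodule.Quotient.mk_eq_zero]
    exact ⟨mem_of_apply_mem_span h hT hs, fun hy => Submodule.subset_span ⟨y, hy, rfl⟩⟩
  rw [← hker, (g.quotKerEquivOfSurjective hg).length_eq, hker]
  refine length_eq_of_forall_exists_smul fun s => ?_
  obtain ⟨r, hr⟩ := hs s
  refine ⟨r, fun q => ?_⟩
  obtain ⟨q, rfl⟩ := N'.mkQ_surjective q
  change N'.mkQ (s • q) = N'.mkQ (r • q)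
  rw [← sub_eq_zero, ← map_sub, Submodule.mkQ_apply, Submodule.Quotient.mk_eq_zero]
  exact hTN (hr q)

end

variable {R S : Type*} [CommRing R] [IsLocalRing R] [CommRing S] [IsLocalRing S] [Algebra R S]

namespace IsCompletionMap

theorem map_pow (hφ : IsCompletionMap R S) (k : ℕ) :
    (maximalIdeal R ^ k).map (algebraMap R S) = maximalIdeal S ^ k := by
  rw [Ideal.map_pow, hφ.map_maximalIdeal]

theorem mem_of_map_mem (hφ : IsCompletionMap R S) {L : Ideal R} {k : ℕ}
    (hk : maximalIdeal R ^ k ≤ L) {r : R} (hr : algebraMap R S r ∈ L.map (algebraMap R S)) :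
    r ∈ L :=
  mem_of_apply_mem_span (Algebra.linearMap R S) (T := maximalIdeal S ^ k)
    (fun y hy => hk (hφ.mem_pow k y hy))
    (fun s => by
      obtain ⟨r, hr⟩ := hφ.exists_sub_mem k s
      refine ⟨r, fun q => ?_⟩
      rw [smul_eq_mul, Algebra.smul_def, ← sub_mul]
      exact Ideal.mul_mem_right _ _ hr) hr

theorem length_quotient_map (hφ : IsCompletionMap R S) {L : Ideal R} {k : ℕ}
    (hk : maximalIdeal R ^ k ≤ L) :
    Module.length R (R ⧸ L) = Module.length S (S ⧸ L.map (algebraMap R S)) :=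
  length_quotient_span_image (Algebra.linearMap R S) (T := maximalIdeal S ^ k)
    (fun y hy => hk (hφ.mem_pow k y hy)) (by
      rw [← hφ.map_pow]
      exact Ideal.map_mono hk)
    (fun s => by
      obtain ⟨r, hr⟩ := hφ.exists_sub_mem k s
      refine ⟨r, fun q => ?_⟩
      rw [smul_eq_mul, Algebra.smul_def, ← sub_mul]
      exact Ideal.mul_mem_right _ _ hr)
    (hφ.exists_sub_mem k)

theorem coordIdeal_le_span (hφ : IsCompletionMap R S) {ι : Type*} [Finite ι]
    {M : Submodule R (ι → R)} {k : ℕ} (hk : coordIdeal ι (maximalIdeal R ^ k) ≤ M) :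
    coordIdeal ι (maximalIdeal S ^ k) ≤
      Submodule.span S ((Algebra.linearMap R S).compLeft ι '' M) := by
  classical
  have := Fintype.ofFinite ι
  intro y hy
  rw [pi_eq_sum_univ' y]
  refine Submodule.sum_mem _ fun i _ => ?_
  have h1 : maximalIdeal S ^ k ≤ (Submodule.span S ((Algebra.linearMap R S).compLeft ι '' M)).comap
      (LinearMap.toSpanSingleton S (ι → S) (Pi.single i 1)) := by
    rw [← hφ.map_pow, Ideal.map_le_iff_le_comap]
    intro r hr
    refine Submodule.subset_span ⟨r • Pi.single i 1, hk (mem_coordIdeal.mpr fun j => ?_), ?_⟩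
    · exact Ideal.mul_mem_right _ _ hr
    · ext j
      by_cases hij : j = i
      · subst hij; simp
      · simp [hij]
  exact h1 (mem_coordIdeal.mp hy i)

theorem length_quotient_span (hφ : IsCompletionMap R S) {ι : Type*} [Finite ι]
    {M : Submodule R (ι → R)} (hM : Cofinite M) :
    Module.length R ((ι → R) ⧸ M) =
      Module.length S ((ι → S) ⧸ Submodule.span S ((Algebra.linearMap R S).compLeft ι '' M)) := by
  obtain ⟨k, hk⟩ := hM
  refine length_quotient_span_image ((Algebra.linearMap R S).compLeft ι)
    (T := coordIdeal ι (maximalIdeal S ^ k)) (fun y hy => ?_) (hφ.coordIdeal_le_span hk)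
    (fun s => ?_) fun q => ?_
  · exact hk (mem_coordIdeal.mpr fun i => hφ.mem_pow k _ (mem_coordIdeal.mp hy i))
  · obtain ⟨r, hr⟩ := hφ.exists_sub_mem k s
    refine ⟨r, fun q => mem_coordIdeal.mpr fun i => ?_⟩
    rw [Pi.sub_apply, Pi.smul_apply, Pi.smul_apply, smul_eq_mul, Algebra.smul_def, ← sub_mul]
    exact Ideal.mul_mem_right _ _ hr
  · choose y hy using fun i => hφ.exists_sub_mem k (q i)
    exact ⟨y, mem_coordIdeal.mpr hy⟩

end IsCompletionMap

theorem exists_pow_le_sup_ofList_pow {R : Type*} [CommRing R] {a : Ideal R} (n : ℕ)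
    (xs : List R) : ∀ {J : Ideal R} {N : ℕ}, a ^ N ≤ J ⊔ Ideal.ofList xs →
      ∃ K, a ^ K ≤ J ⊔ Ideal.ofList (xs.map (· ^ n)) := by
  induction xs with
  | nil => exact fun h => ⟨_, h⟩
  | cons x xs ih =>
    intro J N h
    rw [Ideal.ofList_cons, ← sup_assoc] at h
    obtain ⟨K, hK⟩ := ih h
    rw [sup_right_comm] at hK
    refine ⟨K * n, ?_⟩
    rw [List.map_cons, Ideal.ofList_cons, ← sup_assoc, sup_right_comm]
    exact pow_le_sup_span_pow hK n

theorem ofList_map_pow_le {R : Type*} [CommRing R] {a : Ideal R} {xs : List R}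
    (hxs : ∀ x ∈ xs, x ∈ a) (n : ℕ) : Ideal.ofList (xs.map (· ^ n)) ≤ a ^ n := by
  refine Ideal.span_le.mpr ?_
  rintro y hy
  obtain ⟨x, hx, rfl⟩ := List.mem_map.mp hy
  exact Ideal.pow_mem_pow (hxs x hx) n

/-- An element that starts a regular system of parameters modulo `J` stays regular in the
completion. Powers of the other parameters cut out ideals that contain a power of the maximal
ideal, so that the elements of the completion can be replaced by elements of `R`. -/
theorem IsCompletionMap.regular_map [IsNoetherianRing S] (hφ : IsCompletionMap R S) {J : Ideal R}
    {x : R} {zs : List R} (h : IsRegularSop J (x :: zs)) (s : S)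
    (hs : algebraMap R S x * s ∈ J.map (algebraMap R S)) : s ∈ J.map (algebraMap R S) := by
  have hx := h.mem_maximalIdeal x (by simp)
  refine mem_of_pow_le fun n => ?_
  obtain ⟨N, hN⟩ := h.exists_pow_le
  obtain ⟨K, hK⟩ := exists_pow_le_sup_ofList_pow (n + 1) _ hN
  obtain ⟨r, hr⟩ := hφ.exists_sub_mem (max K n) s
  have h1 : x * r ∈ J ⊔ Ideal.ofList ((x :: zs).map (· ^ (n + 1))) := by
    refine hφ.mem_of_map_mem hK ?_
    have h2 : algebraMap R S (x * r) =
        algebraMap R S x * s - algebraMap R S x * (s - algebraMap R S r) := by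
      rw [map_mul]
      ring
    rw [h2]
    refine sub_mem (Ideal.map_mono le_sup_left hs) (Ideal.mul_mem_left _ _ (Ideal.map_mono hK ?_))
    rw [hφ.map_pow]
    exact Ideal.pow_le_pow_right (le_max_left K n) hr
  rw [List.map_cons, Ideal.ofList_cons, sup_comm (Ideal.span _), ← sup_assoc] at h1
  obtain ⟨c, hc⟩ := mem_sup_span_singleton.mp h1
  have hreg : RegSeq J (x :: zs.map (· ^ (n + 1))) :=
    ⟨h.regSeq.1, h.regSeq.2.map_pow (n + 1)⟩
  have h2 : r - x ^ n * c ∈ J ⊔ Ideal.ofList (zs.map (· ^ (n + 1))) :=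
    hreg.head_regular _ (by convert hc using 1; ring)
  have h3 : r ∈ J ⊔ maximalIdeal R ^ n := by
    rw [← sub_add_cancel r (x ^ n * c)]
    refine add_mem (sup_le_sup_left ?_ J h2) (Submodule.mem_sup_right
      (Ideal.mul_mem_right _ _ (Ideal.pow_mem_pow hx n)))
    exact (ofList_map_pow_le (fun z hz => h.mem_maximalIdeal z (List.mem_cons_of_mem _ hz)) _).trans
      (Ideal.pow_le_pow_right n.le_succ)
  have h4 := Ideal.mem_map_of_mem (algebraMap R S) h3
  rw [Ideal.map_sup, hφ.map_pow] at h4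
  rw [← sub_add_cancel s (algebraMap R S r)]
  exact add_mem (Submodule.mem_sup_right (Ideal.pow_le_pow_right (le_max_right K n) hr)) h4

theorem IsCompletionMap.regSeq_map [IsNoetherianRing S] (hφ : IsCompletionMap R S) (xs : List R) :
    ∀ {J : Ideal R}, IsRegularSop J xs →
      RegSeq (J.map (algebraMap R S)) (xs.map (algebraMap R S)) := by
  induction xs with
  | nil => intros; trivial
  | cons x xs ih =>
    intro J h
    refine ⟨hφ.regular_map h, ?_⟩
    have h1 := h.sup_pow 0
    rw [zero_add, pow_one] at h1
    have := ih h1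
    rwa [Ideal.map_sup, Ideal.map_span, Set.image_singleton] at this

theorem IsCompletionMap.isRegularSop_map [IsNoetherianRing S] (hφ : IsCompletionMap R S)
    {J : Ideal R} {xs : List R} (h : IsRegularSop J xs) :
    IsRegularSop (J.map (algebraMap R S)) (xs.map (algebraMap R S)) where
  le_maximalIdeal := hφ.map_maximalIdeal ▸ Ideal.map_mono h.le_maximalIdeal
  mem_maximalIdeal := by
    intro y hy
    obtain ⟨x, hx, rfl⟩ := List.mem_map.mp hy
    exact hφ.map_maximalIdeal ▸ Ideal.mem_map_of_mem _ (h.mem_maximalIdeal x hx)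
  regSeq := hφ.regSeq_map xs h
  exists_pow_le := by
    obtain ⟨N, hN⟩ := h.exists_pow_le
    refine ⟨N, ?_⟩
    rw [← hφ.map_pow, ← Ideal.map_ofList, ← Ideal.map_sup]
    exact Ideal.map_mono hN

theorem coordIdeal_bot {R ι : Type*} [CommRing R] : coordIdeal ι (⊥ : Ideal R) = ⊥ := by
  ext y
  rw [mem_coordIdeal, Submodule.mem_bot]
  exact funext_iff.symm

/-- Descent of the equality of colengths from the completion. -/
theorem IsCompletionMap.length_eq (k : Type*) [Field k] [Infinite k] [IsNoetherianRing S]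
    [Algebra k S] (hφ : IsCompletionMap R S) {u : R} {ys : List R}
    (h : IsRegularSop (⊥ : Ideal R) (u :: ys)) {p n : ℕ} (hn : n + 1 = (ys.length + 1) + p)
    (a : Fin n → Fin p → R) (ha : Cofinite (Submodule.span R (Set.range a))) :
    Module.length R ((Fin p → R) ⧸ Submodule.span R (Set.range a)) =
      Module.length R (R ⧸ minorIdeal (Submodule.span R (Set.range a))) := by
  let a' : Fin n → Fin p → S := fun i j => algebraMap R S (a i j)
  have hspan : Submodule.span S ((Algebra.linearMap R S).compLeft (Fin p) ''
      (Submodule.span R (Set.range a))) = Submodule.span S (Set.range a') := by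
    refine le_antisymm (Submodule.span_le.mpr ?_) (Submodule.span_mono ?_)
    · rw [← Submodule.map_coe, Submodule.map_span, ← Set.range_comp]
      exact Submodule.span_subset_span R S _
    · rintro _ ⟨i, rfl⟩
      exact ⟨a i, Submodule.subset_span ⟨i, rfl⟩, rfl⟩
  let f : (Fin n → S) →ₗ[S] (Fin p → S) := Fintype.linearCombination S a'
  have hf : LinearMap.range f = Submodule.span S (Set.range a') := Fintype.range_linearCombination S a'
  have hcof : Cofinite (Submodule.span S (Set.range a')) := by
    obtain ⟨l, hl⟩ := ha
    exact ⟨l, hspan ▸ hφ.coordIdeal_le_span hl⟩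
  obtain ⟨l, hl⟩ := Cofinite.exists_pow_le_minorIdeal (I := ⊥)
    (ha.mono (le_sup_left : _ ≤ _ ⊔ coordIdeal (Fin p) (⊥ : Ideal R)))
  rw [sup_bot_eq] at hl
  have h1 := hφ.isRegularSop_map h
  rw [Ideal.map_bot, List.map_cons] at h1
  have h2 := (colengthFormula_and_syzygiesCramer k _ h1).1 p n f (by rwa [List.length_map])
    (hf ▸ hcof.mono le_sup_left)
  rw [hf, coordIdeal_bot, sup_bot_eq, sup_bot_eq] at h2
  rw [hφ.length_quotient_span ha, hspan, h2, minorIdeal_span_range_map (algebraMap R S) a,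
    ← hφ.length_quotient_map hl]

end Transfer

/-! ### The completion of a local algebra -/

section Completion

variable (k : Type*) {R : Type*} [Field k] [CommRing R] [Algebra k R]

theorem map_idealOfVars_pow_le {σ : Type*} {m : Ideal R} {x : σ → R} (hx : ∀ i, x i ∈ m) (n : ℕ) :
    MvPolynomial.idealOfVars σ k ^ n ≤ (m ^ n).comap (MvPolynomial.aeval (R := k) x) := by
  rw [← Ideal.map_le_iff_le_comap, Ideal.map_pow]
  refine Ideal.pow_right_mono (Ideal.map_le_iff_le_comap.mpr (Ideal.span_le.mpr ?_)) n
  rintro _ ⟨i, rfl⟩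
  simpa using hx i

/-- Substitution of elements `xᵢ` of an ideal `𝔪` into formal power series, with values modulo
`𝔪ⁿ`: only the terms of degree less than `n` matter. -/
noncomputable def evalPowerSeriesMod {σ : Type*} [Finite σ] {m : Ideal R} {x : σ → R}
    (hx : ∀ i, x i ∈ m) (n : ℕ) : MvPowerSeries σ k →+* R ⧸ m ^ n :=
  (Ideal.Quotient.lift (MvPolynomial.idealOfVars σ k ^ n)
    ((Ideal.Quotient.mk (m ^ n)).comp (MvPolynomial.aeval (R := k) x).toRingHom) fun _ hp =>
      Ideal.Quotient.eq_zero_iff_mem.mpr (map_idealOfVars_pow_le k hx n hp)).comp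
    (MvPowerSeries.truncTotalAlgHom σ k n).toRingHom

theorem evalPowerSeriesMod_apply {σ : Type*} [Finite σ] {m : Ideal R} {x : σ → R}
    (hx : ∀ i, x i ∈ m) (n : ℕ) (f : MvPowerSeries σ k) : evalPowerSeriesMod k hx n f =
      Ideal.Quotient.mk (m ^ n) (MvPolynomial.aeval x (MvPowerSeries.truncTotal n f)) := rfl

theorem evalPowerSeriesMod_coe {σ : Type*} [Finite σ] {m : Ideal R} {x : σ → R}
    (hx : ∀ i, x i ∈ m) (n : ℕ) (p : MvPolynomial σ k) : evalPowerSeriesMod k hx n p =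
      Ideal.Quotient.mk (m ^ n) (MvPolynomial.aeval x p) := by
  rw [evalPowerSeriesMod_apply, Ideal.Quotient.eq, ← map_sub]
  refine map_idealOfVars_pow_le k hx n (Ideal.Quotient.eq.mp ?_)
  exact (MvPowerSeries.truncTotalAlgHom σ k n).commutes p

theorem factorPow_comp_evalPowerSeriesMod {σ : Type*} [Finite σ] {m : Ideal R} {x : σ → R}
    (hx : ∀ i, x i ∈ m) {a b : ℕ} (hab : a ≤ b) :
    (Ideal.Quotient.factorPow m hab).comp (evalPowerSeriesMod k hx b) =
      evalPowerSeriesMod k hx a := by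
  ext f
  have h := map_idealOfVars_pow_le k hx a
    (MvPowerSeries.truncTotal_sub_truncTotal_mem_pow_idealOfVars hab le_rfl f)
  rw [Ideal.mem_comap, map_sub, ← Ideal.Quotient.eq] at h
  exact h

/-- Substitution of elements `xᵢ` of an ideal `𝔪` into formal power series, with values in the
`𝔪`-adic completion. -/
noncomputable def evalPowerSeries {σ : Type*} [Finite σ] {m : Ideal R} {x : σ → R}
    (hx : ∀ i, x i ∈ m) : MvPowerSeries σ k →+* AdicCompletion m R :=
  AdicCompletion.liftRingHom m (evalPowerSeriesMod k hx) (factorPow_comp_evalPowerSeriesMod k hx)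

theorem evalPowerSeries_coe {σ : Type*} [Finite σ] {m : Ideal R} {x : σ → R}
    (hx : ∀ i, x i ∈ m) (p : MvPolynomial σ k) :
    evalPowerSeries k hx p = algebraMap R (AdicCompletion m R) (MvPolynomial.aeval x p) := by
  refine AdicCompletion.ext_evalₐ fun n => ?_
  rw [evalPowerSeries, AdicCompletion.evalₐ_liftRingHom m _
    (factorPow_comp_evalPowerSeriesMod k hx), AdicCompletion.algebraMap_apply,
    AdicCompletion.evalₐ_of, evalPowerSeriesMod_coe]
  rfl

variable [IsLocalRing R]

theorem mem_maximalIdeal_pow_iff (hfg : (maximalIdeal R).FG)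
    [IsLocalRing (AdicCompletion (maximalIdeal R) R)] (n : ℕ)
    (s : AdicCompletion (maximalIdeal R) R) :
    s ∈ maximalIdeal (AdicCompletion (maximalIdeal R) R) ^ n ↔
      AdicCompletion.evalₐ (maximalIdeal R) n s = 0 := by
  rw [AdicCompletion.maximalIdeal_eq_map_of_fg hfg, ← Ideal.map_pow,
    ← Submodule.restrictScalars_mem R, ← Ideal.smul_top_eq_map,
    AdicCompletion.pow_smul_top_eq_ker_eval hfg, LinearMap.mem_ker]
  have h : (maximalIdeal R ^ n • ⊤ : Ideal R) = maximalIdeal R ^ n := by simp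
  rw [← AdicCompletion.factor_eval_eq_evalₐ _ _ h.le]
  exact (map_eq_zero_iff (Ideal.quotEquivOfEq h) (Ideal.quotEquivOfEq h).injective).symm

theorem isCompletionMap_adicCompletion (hfg : (maximalIdeal R).FG)
    [IsLocalRing (AdicCompletion (maximalIdeal R) R)] :
    IsCompletionMap R (AdicCompletion (maximalIdeal R) R) where
  map_maximalIdeal := (AdicCompletion.maximalIdeal_eq_map_of_fg hfg).symm
  exists_sub_mem n s := by
    obtain ⟨r, hr⟩ := Ideal.Quotient.mk_surjective (AdicCompletion.evalₐ (maximalIdeal R) n s)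
    refine ⟨r, ?_⟩
    rw [mem_maximalIdeal_pow_iff hfg, map_sub, AdicCompletion.algebraMap_apply,
      AdicCompletion.evalₐ_of, ← hr]
    exact sub_self _
  mem_pow n r hr := by
    rw [mem_maximalIdeal_pow_iff hfg, AdicCompletion.algebraMap_apply,
      AdicCompletion.evalₐ_of] at hr
    exact Ideal.Quotient.eq_zero_iff_mem.mp hr

/-- Cohen's structure theorem for a local ring that contains its residue field: the completion is
a quotient of a power series ring. -/
theorem isNoetherianRing_adicCompletion (hfg : (maximalIdeal R).FG)
    (hres : ∀ r : R, ∃ c : k, r - algebraMap k R c ∈ maximalIdeal R) :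
    IsNoetherianRing (AdicCompletion (maximalIdeal R) R) := by
  have := AdicCompletion.isLocalRing_of_fg hfg
  obtain ⟨n, x, hx⟩ := Submodule.fg_iff_exists_fin_generating_family.mp hfg
  have hxm : ∀ i, x i ∈ maximalIdeal R := fun i => hx ▸ Submodule.subset_span ⟨i, rfl⟩
  let F := evalPowerSeries k hxm
  have hmap : (Ideal.span (Set.range MvPowerSeries.X)).map F =
      (maximalIdeal R).map (algebraMap R (AdicCompletion (maximalIdeal R) R)) := by
    have h1 : ∀ (φ : R →+* AdicCompletion (maximalIdeal R) R),
        (maximalIdeal R).map φ = (Ideal.span (Set.range x)).map φ :=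
      fun φ => congrArg (Ideal.map φ) hx.symm
    rw [h1, Ideal.map_span, Ideal.map_span, ← Set.range_comp, ← Set.range_comp]
    congr 2
    ext1 i
    have := evalPowerSeries_coe k hxm (MvPolynomial.X i)
    rwa [MvPolynomial.coe_X, MvPolynomial.aeval_X] at this
  have hcomplete := AdicCompletion.isAdicComplete_self _ hfg
  have : IsHausdorff ((Ideal.span (Set.range MvPowerSeries.X)).map F)
      (AdicCompletion (maximalIdeal R) R) := hmap ▸ hcomplete.toIsHausdorff
  have hF : Function.Surjective F := by
    refine surjective_of_mk_map_comp_surjective (I := Ideal.span (Set.range MvPowerSeries.X)) F ?_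
    intro y
    obtain ⟨s, rfl⟩ := Ideal.Quotient.mk_surjective y
    obtain ⟨r, hr⟩ := (isCompletionMap_adicCompletion hfg).exists_sub_mem 1 s
    obtain ⟨c, hc⟩ := hres r
    refine ⟨(MvPolynomial.C c : MvPolynomial (Fin n) k), ?_⟩
    rw [RingHom.comp_apply, eq_comm, Ideal.Quotient.eq, hmap]
    have h1 : F (MvPolynomial.C c : MvPolynomial (Fin n) k) =
        algebraMap R _ (algebraMap k R c) := by
      have := evalPowerSeries_coe k hxm (MvPolynomial.C c)
      rwa [MvPolynomial.aeval_C] at this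
    rw [h1, ← sub_add_sub_cancel s (algebraMap R _ r), ← map_sub]
    refine add_mem ?_ (Ideal.mem_map_of_mem _ hc)
    rwa [pow_one, AdicCompletion.maximalIdeal_eq_map_of_fg hfg] at hr
  exact isNoetherianRing_of_surjective _ _ F hF

end Completion

section LocalAlgebra

variable {R : Type*} [CommRing R] [IsLocalRing R]

theorem maximalIdeal_fg_of_isFiniteLength {xs : List R} (hxs : ∀ x ∈ xs, x ∈ maximalIdeal R)
    (h : IsFiniteLength R (R ⧸ Ideal.ofList xs)) : (maximalIdeal R).FG := by
  classical
  obtain ⟨_, _⟩ := isFiniteLength_iff_isNoetherian_isArtinian.mp h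
  refine Submodule.fg_of_fg_map_of_fg_inf_ker (Ideal.ofList xs).mkQ (IsNoetherian.noetherian _) ?_
  rw [Submodule.ker_mkQ, inf_eq_right.mpr (show Ideal.ofList xs ≤ _ from Ideal.span_le.mpr hxs)]
  exact ⟨xs.toFinset, by simp [Ideal.ofList]⟩

end LocalAlgebra

/-! ### Cohen–Macaulay local algebras -/

section CohenMacaulay

theorem regSeq_of_forall_take {R : Type*} [CommRing R] (xs : List R) : ∀ {J : Ideal R},
    (∀ (i : ℕ) (hi : i < xs.length) (y : R), xs[i] * y ∈ J ⊔ Ideal.ofList (xs.take i) →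
      y ∈ J ⊔ Ideal.ofList (xs.take i)) → RegSeq J xs := by
  induction xs with
  | nil => intros; trivial
  | cons x xs ih =>
    intro J h
    refine ⟨fun y hy => by simpa using h 0 (by simp) y (by simpa using hy), ih fun i hi y hy => ?_⟩
    have := h (i + 1) (by simpa using hi) y
    rw [List.take_succ_cons, Ideal.ofList_cons, ← sup_assoc] at this
    exact this hy

theorem regSeq_of_isWeaklyRegular {R : Type*} [CommRing R] {xs : List R}
    (h : RingTheory.Sequence.IsWeaklyRegular R xs) : RegSeq (⊥ : Ideal R) xs := by
  refine regSeq_of_forall_take xs fun i hi y hy => ?_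
  rw [bot_sup_eq] at hy ⊢
  have h1 : (Ideal.ofList (xs.take i) • ⊤ : Submodule R R) = Ideal.ofList (xs.take i) := by simp
  have h2 := h.regular_mod_prev i hi
  rw [h1] at h2
  rw [← Submodule.Quotient.mk_eq_zero] at hy ⊢
  refine h2 ?_
  change xs[i] • _ = xs[i] • _
  rw [smul_zero, ← Submodule.Quotient.mk_smul]
  exact hy

variable {R : Type*} [CommRing R] [IsLocalRing R]

theorem exists_pow_smul_top_le {F : Type*} [AddCommGroup F] [Module R F] {M : Submodule R F}
    (h : IsFiniteLength R (F ⧸ M)) : ∃ n, maximalIdeal R ^ n • (⊤ : Submodule R F) ≤ M := by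
  obtain ⟨n, hn⟩ := exists_pow_le_of_isFiniteLength h
  refine ⟨n, ?_⟩
  rw [← Submodule.ker_mkQ M, LinearMap.le_ker_iff_map, Submodule.map_smul'', eq_bot_iff, ← hn]
  exact smul_mono_right _ le_top

theorem cofinite_of_isFiniteLength {ι : Type*} [Finite ι] {M : Submodule R (ι → R)}
    (h : IsFiniteLength R ((ι → R) ⧸ M)) : Cofinite M := by
  classical
  have := Fintype.ofFinite ι
  obtain ⟨n, hn⟩ := exists_pow_smul_top_le h
  refine ⟨n, fun y hy => hn ?_⟩
  rw [pi_eq_sum_univ' y]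
  exact Submodule.sum_mem _ fun i _ =>
    Submodule.smul_mem_smul (mem_coordIdeal.mp hy i) Submodule.mem_top

theorem isRegularSop_bot {xs : List R} (h : IsSystemOfParameters R xs)
    (hreg : RingTheory.Sequence.IsRegular R xs) : IsRegularSop (⊥ : Ideal R) xs where
  le_maximalIdeal := bot_le
  mem_maximalIdeal := h.2.1
  regSeq := regSeq_of_isWeaklyRegular hreg.toIsWeaklyRegular
  exists_pow_le := by
    obtain ⟨n, hn⟩ := exists_pow_smul_top_le h.2.2
    exact ⟨n, by simpa using hn⟩

/-- The equality of colengths over a Cohen–Macaulay local ring that contains its infinite residue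
field. The ring itself need not be known to be Noetherian, since its completion is. -/
theorem length_quotient_eq_of_isCohenMacaulay (k : Type*) [Field k] [Infinite k] [Algebra k R]
    (hres : ∀ r : R, ∃ c : k, r - algebraMap k R c ∈ maximalIdeal R) (hCM : IsCohenMacaulay R)
    {d p n : ℕ} (hdim : ringKrullDim R = d) (hd : 1 ≤ d) (hn : n + 1 = d + p)
    (a : Fin n → Fin p → R)
    (ha : IsFiniteLength R ((Fin p → R) ⧸ Submodule.span R (Set.range a))) :
    Module.length R ((Fin p → R) ⧸ Submodule.span R (Set.range a)) =
      Module.length R (R ⧸ minorIdeal (Submodule.span R (Set.range a))) := by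
  obtain ⟨xs, hxs, hreg⟩ := hCM
  have hlen : xs.length = d := by
    have := hxs.1
    rw [hdim] at this
    exact_mod_cast this
  have hfg := maximalIdeal_fg_of_isFiniteLength hxs.2.1 hxs.2.2
  have hsop := isRegularSop_bot hxs hreg
  have := AdicCompletion.isLocalRing_of_fg hfg
  have := isNoetherianRing_adicCompletion k hfg hres
  obtain _ | ⟨u, ys⟩ := xs
  · rw [← hlen] at hd
    exact absurd hd (by simp)
  · rw [List.length_cons] at hlen
    exact (isCompletionMap_adicCompletion hfg).length_eq k hsop (by omega) a
      (cofinite_of_isFiniteLength ha)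

end CohenMacaulay

/-! ### Germs of holomorphic functions -/

section Germs

theorem maximalMinors_eq_minorIdeal {R : Type*} [CommRing R] {p m : ℕ}
    (A : Matrix (Fin p) (Fin m) R) :
    maximalMinors A = minorIdeal (Submodule.span R (Set.range A.col)) := by
  rw [minorIdeal_span_range]
  have key : ∀ s : Fin p → Fin m,
      (Matrix.of fun i => A.col (s i)).det = (A.submatrix id s).det := fun s => by
    rw [← Matrix.det_transpose]
    rfl
  apply le_antisymm
  · refine Ideal.span_mono ?_
    rintro _ ⟨s, rfl⟩
    exact ⟨s, key s⟩
  · refine Ideal.span_le.mpr ?_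
    rintro _ ⟨s, rfl⟩
    simp only [key]
    by_cases hs : Function.Injective s
    · -- An injective choice of columns is a permutation of an increasing one.
      have hcard : (Finset.univ.image s).card = p := by
        rw [Finset.card_image_of_injective _ hs, Finset.card_univ, Fintype.card_fin]
      let t := (Finset.univ.image s).orderEmbOfFin hcard
      have ht : ∀ i, ∃ j, t j = s i := fun i => by
        have : s i ∈ Set.range t := by
          rw [Finset.range_orderEmbOfFin]
          simp
        exact this
      choose σ hσ using ht
      have hσi : Function.Injective σ := fun i j hij => hs (by rw [← hσ i, ← hσ j, hij])
      let π := Equiv.ofBijective σ (Finite.injective_iff_bijective.mp hσi)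
      have h1 : A.submatrix id s = (A.submatrix id t).submatrix id π := by
        ext i j
        simp [π, hσ]
      rw [h1, Matrix.det_permute']
      exact Ideal.mul_mem_left _ _ (Ideal.subset_span ⟨t, rfl⟩)
    · obtain ⟨i, j, hij, hne⟩ := Function.not_injective_iff.mp hs
      rw [Matrix.det_zero_of_column_eq hne fun l => by simp [hij]]
      exact zero_mem _

/-- Germs of constant functions. -/
noncomputable def constGerm (n : ℕ) (z : Fin n → ℂ) : ℂ →+* OAmbient n z where
  toFun c := ⟨((fun _ => c : (Fin n → ℂ) → ℂ) : (𝓝 z).Germ ℂ), _, analyticAt_const, rfl⟩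
  map_one' := rfl
  map_mul' _ _ := rfl
  map_zero' := rfl
  map_add' _ _ := rfl

theorem exists_sub_constGerm_mem {n : ℕ} {z : Fin n → ℂ} (g : OAmbient n z) :
    ∃ c : ℂ, g - constGerm n z c ∈ maximalIdeal (OAmbient n z) := by
  obtain ⟨_, f, hf, rfl⟩ := g
  refine ⟨f z, ?_⟩
  rw [mem_maximalIdeal, mem_nonunits_iff]
  intro hu
  have h := ((hu.map (holoGerms n z).subtype).map (Germ.valueRingHom (E := ℂ))).ne_zero
  refine h ?_
  change f z - f z = 0
  exact sub_self _

end Germs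

end AnalyticSpace

theorem theorem1p3 {n : ℕ} {z : Fin n → ℂ} (I : Ideal (AnalyticSpace.OAmbient n z))
    [Nontrivial (AnalyticSpace.OLocal I)] (d p : ℕ) (hd : 1 ≤ d)
    (hdim : ringKrullDim (AnalyticSpace.OLocal I) = d)
    (hCM : AnalyticSpace.IsCohenMacaulay (AnalyticSpace.OLocal I))
    (M : Submodule (AnalyticSpace.OLocal I) (Fin p → AnalyticSpace.OLocal I))
    (hM : IsFiniteLength (AnalyticSpace.OLocal I) ((Fin p → AnalyticSpace.OLocal I) ⧸ M))
    (A : Matrix (Fin p) (Fin (d + p - 1)) (AnalyticSpace.OLocal I))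
    (hA : Submodule.span (AnalyticSpace.OLocal I) (Set.range A.col) = M) :
    Module.length (AnalyticSpace.OLocal I) ((Fin p → AnalyticSpace.OLocal I) ⧸ M) =
      Module.length (AnalyticSpace.OLocal I)
        (AnalyticSpace.OLocal I ⧸ AnalyticSpace.maximalMinors A) := by
  open AnalyticSpace in
  subst hA
  let φ : ℂ →+* OLocal I := (Ideal.Quotient.mk I).comp (constGerm n z)
  let : Algebra ℂ (OLocal I) := φ.toAlgebra
  rw [maximalMinors_eq_minorIdeal]
  refine length_quotient_eq_of_isCohenMacaulay ℂ (fun r => ?_) hCM hdim hd (by omega) A.col hM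
  obtain ⟨g, rfl⟩ := Ideal.Quotient.mk_surjective r
  obtain ⟨c, hc⟩ := exists_sub_constGerm_mem g
  refine ⟨c, ?_⟩
  rw [← map_maximalIdeal_quotient]
  exact Ideal.mem_map_of_mem (Ideal.Quotient.mk I) hc
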